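/- Let $K$ be a perfect field, let $n\ge 0$ and $P=K[X_0,\dots,X_n]$. Let $\mathbb{X}$ be a 0-dimensional closed subscheme of $\mathbb{P}^n_K$ with saturated homogeneous vanishing ideal $I_{\mathbb{X}}\subseteq P$ (so $\dim P/I_{\mathbb{X}}=1$) and homogeneous coordinate ring $R=P/I_{\mathbb{X}}$. Let $\mathbb{Y}$ be the differential fattening of $\mathbb{X}$, that is, the 0-dimensional scheme whose saturated homogeneous vanishing ideal is $$I_{\mathbb{Y}}=\{f\in P \mid \delta(f)\in I_{\mathbb{X}} \text{ for every } K\text{-linear differential operator } \delta \text{ of } P \text{ of order at most } 1\}.$$ Let $\Omega^1_R$ be the module of Kähler differentials of $R/K$, graded so that $\deg(f\,dg)=\deg f+\deg g$ for homogeneous $f,g\in R$. For a finitely generated graded $R$-module $M$, let $\mathrm{HF}_M(i)=\dim_K M_i$ $(i\in\mathbb{Z})$ be its Hilbert function, $\mathrm{HP}(M)$ its Hilbert polynomial, and $\mathrm{ri}(M)$ its regularity index, i.e. the least $i\in\mathbb{Z}$ such that $\mathrm{HF}_M(j)=\mathrm{HP}(M)(j)$ for all $j\ge i$. Write $\mathrm{HF}_{\mathbb{X}}=\mathrm{HF}_R$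 and $r_{\mathbb{X}}=\mathrm{ri}(R)$, let $\deg\mathbb{X}$ be the value of the constant polynomial $\mathrm{HP}(R)$, and define $\mathrm{HF}_{\mathbb{Y}}, r_{\mathbb{Y}},\deg\mathbb{Y}$ in the same way from $P/I_{\mathbb{Y}}$. All these Hilbert polynomials and regularity indices exist, and the following holds. (a) For all $i\in\mathbb{N}$, $$\mathrm{HF}_{\Omega^1_R}(i)=(n+1)\,\mathrm{HF}_{\mathbb{X}}(i-1)+\mathrm{HF}_{\mathbb{X}}(i)-\mathrm{HF}_{\mathbb{Y}}(i).$$ In particular $\mathrm{HP}(\Omega^1_R)=(n+2)\deg\mathbb{X}-\deg\mathbb{Y}$ and $\mathrm{ri}(\Omega^1_R)\le\max\{r_{\mathbb{X}}+1,\,r_{\mathbb{Y}}\}$. (b) Let $p\ge 0$ be the characteristic of $K$, and suppose that $\mathbb{X}=m_1p_1+\cdots+m_sp_s$ is a fat point scheme: $p_1,\dots,p_s$ are distinct $K$-rational points of $\mathbb{P}^n_K$ with homogeneous vanishing ideals $I_{p_j}$, the $m_j$ are positive integers, and $I_{\mathbb{X}}=I_{p_1}^{m_1}\cap\cdots\cap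 I_{p_s}^{m_s}$. (i) We have $$\mathrm{HP}(\Omega^1_R)=\sum_{j=1}^s\left[(n+2)\binom{m_j+n-1}{n}-\binom{m_j+n}{n}\right]+\sum_{p\mid m_j}\#\Big\{(\alpha_1,\dots,\alpha_n)\in\mathbb{N}^n \;\Big|\; \sum_{i=1}^n\alpha_i=\frac{m_j}{p}\Big\},$$ where the second sum runs over all $j\in\{1,\dots,s\}$ with $p\mid m_j$ (it is empty if $p=0$). (ii) If $n\ge 1$, then $m_1=\cdots=m_s=1$ if and only if $\mathrm{HP}(\Omega^1_R)=s$. -/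

import Mathlib

noncomputable section

/-! ### Differential operators and differential powers -/

/-- `IsDiffOp K R m δ`: the `K`-linear map `δ : R → R` is a `K`-linear differential operator of order
at most `m`. Operators of order at most `0` are the `R`-linear maps, and `δ` has order at most
`m + 1` when every commutator `[δ, f] = δ ∘ μ_f - μ_f ∘ δ` has order at most `m`, where `μ_f` is
multiplication by `f`. -/
def IsDiffOp (K R : Type*) [CommRing K] [CommRing R] [Algebra K R] : ℕ → (R →ₗ[K] R) → Prop
  | 0, δ => ∀ f g : R, δ (f * g) = f * δ g
  | m + 1, δ => ∀ f : R,
      IsDiffOp K R m (δ ∘ₗ LinearMap.mulLeft K f - LinearMap.mulLeft K f ∘ₗ δ)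

theorem IsDiffOp.comp_mulLeft {K R : Type*} [CommRing K] [CommRing R] [Algebra K R] (m : ℕ)
    (δ : R →ₗ[K] R) (h : IsDiffOp K R m δ) (a : R) :
    IsDiffOp K R m (δ ∘ₗ LinearMap.mulLeft K a) := by
  induction m generalizing δ with
  | zero =>
    intro f g
    simp only [LinearMap.comp_apply, LinearMap.mulLeft_apply]
    rw [mul_left_comm, h]
  | succ m ih =>
    intro f
    have := ih _ (h f)
    convert this using 1
    ext g
    simp [mul_left_comm]

/-- The `m`-th `K`-linear differential power `J^⟨m⟩` of an ideal `J` of `R`, for `m ≥ 1`: the ideal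
of all `f` such that `δ f ∈ J` for every differential operator `δ` of order at most `m - 1`. -/
def diffPower (K : Type*) {R : Type*} [CommRing K] [CommRing R] [Algebra K R]
    (J : Ideal R) (m : ℕ) : Ideal R where
  carrier := {f | ∀ δ : R →ₗ[K] R, IsDiffOp K R (m - 1) δ → δ f ∈ J}
  add_mem' {f g} hf hg δ hδ := by
    rw [map_add]
    exact J.add_mem (hf δ hδ) (hg δ hδ)
  zero_mem' δ _ := by simp
  smul_mem' a f hf δ hδ := by
    have := hf _ (hδ.comp_mulLeft _ _ a)
    simpa using this

/-! ### Zero-dimensional schemes in projective space -/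

/-- A zero-dimensional closed subscheme of `ℙⁿ` over `K`, given by its saturated homogeneous
vanishing ideal in `P = K[X_0, …, X_n]`. Its homogeneous coordinate ring is one-dimensional. -/
structure ZeroDimScheme (K : Type*) [Field K] (n : ℕ) where
  /-- The homogeneous vanishing ideal of the scheme. -/
  ideal : Ideal (MvPolynomial (Fin (n + 1)) K)
  homogeneous : ∀ f ∈ ideal, ∀ d : ℕ, MvPolynomial.homogeneousComponent d f ∈ ideal
  saturated : ∀ f, (∀ i, MvPolynomial.X i * f ∈ ideal) → f ∈ ideal
  dim_eq_one : ringKrullDim (MvPolynomial (Fin (n + 1)) K ⧸ ideal) = 1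

theorem mem_diffPower_two_iff {K : Type*} [Field K] {n : ℕ}
    (I : Ideal (MvPolynomial (Fin (n + 1)) K)) (f : MvPolynomial (Fin (n + 1)) K) :
    f ∈ diffPower K I 2 ↔ f ∈ I ∧ ∀ i, MvPolynomial.pderiv i f ∈ I := by
  constructor
  · intro h
    refine ⟨?_, fun i => ?_⟩
    · refine h LinearMap.id ?_
      intro a b c
      simp
    · refine h (MvPolynomial.pderiv i).toLinearMap ?_
      intro a b c
      simp
      ring
  · rintro ⟨h0, h1⟩ δ hδ
    have key : ∀ a g, δ (a * g) = a * δ g + g * δ a - a * g * δ 1 := by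
      intro a g
      have h2 := hδ a g 1
      simp at h2
      linear_combination h2
    let E : Derivation K (MvPolynomial (Fin (n + 1)) K) (MvPolynomial (Fin (n + 1)) K) :=
      Derivation.mk' (δ - LinearMap.mulRight K (δ 1)) (by
        intro a b
        simp [key a b]
        ring)
    have hsum : ∀ (D : Fin (n + 1) → Derivation K (MvPolynomial (Fin (n + 1)) K)
        (MvPolynomial (Fin (n + 1)) K)) g, (∑ i, D i) g = ∑ i, D i g := by
      intro D g
      have := congrFun (map_sum (Derivation.coeFnAddMonoidHom (R := K)
        (A := MvPolynomial (Fin (n + 1)) K) (M := MvPolynomial (Fin (n + 1)) K)) D Finset.univ) g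
      rw [Finset.sum_apply] at this
      exact this
    have hE : E = ∑ i, E (MvPolynomial.X i) • MvPolynomial.pderiv i := by
      apply MvPolynomial.derivation_ext
      intro j
      rw [hsum]
      simp [MvPolynomial.pderiv_X, Pi.single_apply]
    have hf : δ f = E f + f * δ 1 := by
      simp [E]
    rw [hf, hE, hsum]
    refine I.add_mem (I.sum_mem fun i _ => ?_) (I.mul_mem_right _ h0)
    exact I.mul_mem_left _ (h1 i)

theorem homogeneousComponent_pderiv {K : Type*} [Field K] {n : ℕ}
    (f : MvPolynomial (Fin (n + 1)) K) (i : Fin (n + 1)) (d : ℕ) :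
    MvPolynomial.homogeneousComponent d (MvPolynomial.pderiv i f) =
      MvPolynomial.pderiv i (MvPolynomial.homogeneousComponent (d + 1) f) := by
  ext e
  simp only [MvPolynomial.coeff_homogeneousComponent, MvPolynomial.coeff_pderiv]
  simp

/-- The differential fattening `𝕐` of `𝕏`: the zero-dimensional scheme whose vanishing ideal is the
second differential power `I_𝕏^⟨2⟩` of the vanishing ideal of `𝕏`. -/
def ZeroDimScheme.diffFattening {K : Type*} [Field K] {n : ℕ} (X : ZeroDimScheme K n) :
    ZeroDimScheme K n where
  ideal := diffPower K X.ideal 2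
  homogeneous f hf d := by
    rw [mem_diffPower_two_iff] at hf ⊢
    refine ⟨X.homogeneous f hf.1 d, fun i => ?_⟩
    cases d with
    | zero => simp
    | succ d =>
      rw [← homogeneousComponent_pderiv]
      exact X.homogeneous _ (hf.2 i) d
  saturated f hf := by
    simp only [mem_diffPower_two_iff] at hf ⊢
    have h0 : f ∈ X.ideal := X.saturated f fun i => (hf i).1
    refine ⟨h0, fun j => X.saturated _ fun i => ?_⟩
    have h1 := (hf i).2 j
    rw [MvPolynomial.pderiv_mul] at h1
    exact (X.ideal.add_mem_iff_right (X.ideal.mul_mem_left _ h0)).1 h1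
  dim_eq_one := by
    rw [← X.dim_eq_one, ringKrullDim_quotient, ringKrullDim_quotient]
    have h1 : diffPower K X.ideal 2 ≤ X.ideal := fun f hf =>
      ((mem_diffPower_two_iff _ _).1 hf).1
    have h2 : X.ideal ^ 2 ≤ diffPower K X.ideal 2 := by
      rw [pow_two, Ideal.mul_le]
      intro a ha b hb
      rw [mem_diffPower_two_iff]
      refine ⟨X.ideal.mul_mem_left _ hb, fun i => ?_⟩
      rw [MvPolynomial.pderiv_mul]
      exact X.ideal.add_mem (X.ideal.mul_mem_left _ hb) (X.ideal.mul_mem_right _ ha)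
    have h3 : PrimeSpectrum.zeroLocus (diffPower K X.ideal 2 : Set _) =
        PrimeSpectrum.zeroLocus (X.ideal : Set (MvPolynomial (Fin (n + 1)) K)) := by
      apply le_antisymm
      · rw [← PrimeSpectrum.zeroLocus_pow X.ideal two_ne_zero]
        exact PrimeSpectrum.zeroLocus_anti_mono h2
      · exact PrimeSpectrum.zeroLocus_anti_mono h1
    rw [h3]

/-! ### Hilbert functions -/

/-- The Hilbert function `i ↦ dim_K M_i` of a graded module given by its homogeneous components. -/
def hilbertFun {K M : Type*} [Field K] [AddCommGroup M] [Module K M]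
    (ℳ : ℤ → Submodule K M) (i : ℤ) : ℤ :=
  Module.finrank K (ℳ i)

/-- `q` is a Hilbert polynomial of `F`: it agrees with `F` at all large integers. -/
def IsHilbertPoly (F : ℤ → ℤ) (q : Polynomial ℚ) : Prop :=
  ∃ N : ℤ, ∀ i ≥ N, (F i : ℚ) = q.eval (i : ℚ)

open Classical in
/-- The Hilbert polynomial of `F` (unique if it exists, and `0` if there is none). -/
def hilbertPoly (F : ℤ → ℤ) : Polynomial ℚ :=
  if h : ∃ q, IsHilbertPoly F q then h.choose else 0

/-- The integers from which on `F` agrees with its Hilbert polynomial. -/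
def regularitySet (F : ℤ → ℤ) : Set ℤ :=
  {i | ∀ j ≥ i, (F j : ℚ) = (hilbertPoly F).eval (j : ℚ)}

/-- The regularity index of `F`: the least element of `regularitySet F`. -/
def regularityIndex (F : ℤ → ℤ) : ℤ := sInf (regularitySet F)

namespace ZeroDimScheme

variable {K : Type*} [Field K] {n : ℕ} (X : ZeroDimScheme K n)

/-- The homogeneous coordinate ring `R = P / I_𝕏`. -/
abbrev coordRing : Type _ := MvPolynomial (Fin (n + 1)) K ⧸ X.ideal

/-- The homogeneous component `R_i` of the homogeneous coordinate ring: the image of the forms of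
degree `i`, which is zero for `i < 0`. -/
def coordComponent : ℤ → Submodule K X.coordRing
  | Int.ofNat d => (MvPolynomial.homogeneousSubmodule (Fin (n + 1)) K d).map
      (Ideal.Quotient.mkₐ K X.ideal).toLinearMap
  | Int.negSucc _ => ⊥

/-- The homogeneous component of degree `i` of `Ω¹_R`, the module of Kähler differentials of `R / K`
with the grading induced from that of `R`: it is spanned by the `f dg` with `f`, `g` homogeneous and
`deg f + deg g = i`; in particular `deg (dx_j) = 1`. -/
def kaehlerComponent (i : ℤ) : Submodule K (KaehlerDifferential K X.coordRing) :=
  Submodule.span K {ω | ∃ a b : ℤ, a + b = i ∧ ∃ f ∈ X.coordComponent a, ∃ g ∈ X.coordComponent b,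
    ω = f • KaehlerDifferential.D K X.coordRing g}

/-- The Hilbert function `HF_𝕏 = HF_R` of the scheme. -/
def HF : ℤ → ℤ := hilbertFun X.coordComponent

/-- The Hilbert function of `Ω¹_R`. -/
def HFOmega : ℤ → ℤ := hilbertFun X.kaehlerComponent

/-- The degree of the scheme: its Hilbert polynomial is a constant, and the degree is its value. -/
def degree : ℚ := (hilbertPoly X.HF).coeff 0

end ZeroDimScheme

/-- The homogeneous vanishing ideal of a `K`-rational point of `ℙⁿ`: the ideal generated by the
homogeneous polynomials that vanish at the point. -/
def pointIdeal {K : Type*} [Field K] {n : ℕ} (q : Projectivization K (Fin (n + 1) → K)) :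
    Ideal (MvPolynomial (Fin (n + 1)) K) :=
  Ideal.span {f | (∃ d : ℕ, f.IsHomogeneous d) ∧ MvPolynomial.eval q.rep f = 0}

/-- `X` is the fat point scheme `m_1 q_1 + ⋯ + m_s q_s`, for distinct `K`-rational points `q_j` and
multiplicities `m_j ≥ 1`: its vanishing ideal is the intersection of the powers of the vanishing
ideals of the points. -/
structure IsFatPointScheme {K : Type*} [Field K] {n s : ℕ} (X : ZeroDimScheme K n)
    (q : Fin s → Projectivization K (Fin (n + 1) → K)) (m : Fin s → ℕ) : Prop where
  distinct : Function.Injective q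
  pos : ∀ j, 1 ≤ m j
  ideal_eq : X.ideal = ⨅ j, pointIdeal (q j) ^ m j

end

/-! Part (a) is a dimension count. In degree d + 1 there is an exact sequence 0 → (I_𝕐)_{d+1} →
(I_𝕏)_{d+1} → (R_d)^{n+1} → (Ω¹_R)_{d+1} → 0, where the middle map is the gradient and the last one
sends (h_k) to ∑ h_k dx_k. By `mem_diffPower_two_iff`, the kernel of the gradient on I_𝕏 consists of
the forms lying in I_𝕐. Exactness at (R_d)^{n+1} is the conormal sequence of P → R cut down to one
degree (`range_gradComponent`). `HFOmega_succ` adds up the dimensions.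

The Hilbert polynomials exist because HF_𝕏 is monotone and bounded. Saturation says that no nonzero
element of R is killed by all x_k. By McCoy's theorem ∑ x_k T^k is then a nonzerodivisor on R[T],
which gives monotonicity over any field, finite ones included (`finrank_le_finrank_of_mul_mem`).
Noether normalization makes R finite over some K[y], so the partial sums of HF_𝕏 grow at most
linearly, and a monotone function with this property is bounded. The same applies to 𝕐, and the
formula in (a) transfers everything to Ω¹_R.

For (b), the ideals of distinct points are comaximal up to a power of the irrelevant ideal, so in
large degrees the Chinese remainder theorem splits the Hilbert functions of 𝕏 and 𝕐 into local terms
(`finrank_quotComponent_iInf`). A linear change of coordinates moves each point to a coordinate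
point, where both local ideals are monomial. Derivatives only test the monomials of local degree
m_j. Those whose exponents in the local variables are all divisible by p escape the test, and they
produce the correction sum. For (ii), a summand is 1 when m_j = 1 and at least 2 when m_j ≥ 2, and
the correction is nonnegative. -/

noncomputable section

open MvPolynomial

/-! ### Graded pieces of quotients of the polynomial ring -/

section GradedPieces

variable {K : Type*} [Field K] {n : ℕ}

instance finite_homogeneousSubmodule (d : ℕ) :
    Module.Finite K (homogeneousSubmodule (Fin (n + 1)) K d) :=
  Module.Finite.iff_fg.2 (homogeneousSubmodule_fg _ _ d)

/-- The forms of degree `d` in the ideal `J`. -/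
def idealComponent (J : Ideal (MvPolynomial (Fin (n + 1)) K)) (d : ℕ) :
    Submodule K (homogeneousSubmodule (Fin (n + 1)) K d) :=
  (J.restrictScalars K).comap (homogeneousSubmodule (Fin (n + 1)) K d).subtype

/-- The image of the forms of degree `d` in the quotient by the ideal `J`. -/
def quotComponent (J : Ideal (MvPolynomial (Fin (n + 1)) K)) (d : ℕ) :
    Submodule K (MvPolynomial (Fin (n + 1)) K ⧸ J) :=
  (homogeneousSubmodule (Fin (n + 1)) K d).map (Ideal.Quotient.mkₐ K J).toLinearMap

instance (J : Ideal (MvPolynomial (Fin (n + 1)) K)) (d : ℕ) :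
    Module.Finite K (quotComponent J d) := by
  unfold quotComponent; infer_instance

theorem mk_mem_quotComponent (J : Ideal (MvPolynomial (Fin (n + 1)) K)) {d : ℕ}
    {f : MvPolynomial (Fin (n + 1)) K} (hf : f.IsHomogeneous d) :
    Ideal.Quotient.mk J f ∈ quotComponent J d :=
  ⟨f, hf, rfl⟩

theorem mem_quotComponent {J : Ideal (MvPolynomial (Fin (n + 1)) K)} {d : ℕ}
    {x : MvPolynomial (Fin (n + 1)) K ⧸ J} :
    x ∈ quotComponent J d ↔
      ∃ f : MvPolynomial (Fin (n + 1)) K, f.IsHomogeneous d ∧ Ideal.Quotient.mk J f = x :=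
  Iff.rfl

theorem finrank_quotComponent_add (J : Ideal (MvPolynomial (Fin (n + 1)) K)) (d : ℕ) :
    Module.finrank K (quotComponent J d) + Module.finrank K (idealComponent J d) =
      Module.finrank K (homogeneousSubmodule (Fin (n + 1)) K d) := by
  have h := LinearMap.finrank_range_add_finrank_ker
    ((Ideal.Quotient.mkₐ K J).toLinearMap.domRestrict (homogeneousSubmodule (Fin (n + 1)) K d))
  rw [LinearMap.range_domRestrict, LinearMap.ker_domRestrict] at h
  rw [← h]
  have : idealComponent J d = Submodule.comap (homogeneousSubmodule (Fin (n + 1)) K d).subtype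
      (LinearMap.ker (Ideal.Quotient.mkₐ K J).toLinearMap) := by
    ext x
    simp [idealComponent, Ideal.Quotient.eq_zero_iff_mem]
  rw [this]
  rfl

namespace ZeroDimScheme

variable (X : ZeroDimScheme K n)

theorem coordComponent_of_neg {i : ℤ} (hi : i < 0) : X.coordComponent i = ⊥ := by
  cases i with
  | ofNat d => simp at hi; omega
  | negSucc d => rfl

theorem HF_natCast (d : ℕ) : X.HF d = Module.finrank K (quotComponent X.ideal d) := rfl

theorem HF_of_neg {i : ℤ} (hi : i < 0) : X.HF i = 0 := by
  rw [HF, hilbertFun, X.coordComponent_of_neg hi, finrank_bot, Nat.cast_zero]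

theorem ideal_ne_top : X.ideal ≠ ⊤ := by
  intro h
  have := X.dim_eq_one
  have hs : Subsingleton (MvPolynomial (Fin (n + 1)) K ⧸ X.ideal) :=
    Ideal.Quotient.subsingleton_iff.2 h
  rw [ringKrullDim_eq_bot_of_subsingleton] at this
  exact absurd this (by simp)

theorem HF_zero : X.HF 0 = 1 := by
  rw [show (0 : ℤ) = ((0 : ℕ) : ℤ) from rfl, HF_natCast]
  have : quotComponent X.ideal 0 = Submodule.span K {1} := by
    ext x
    rw [mem_quotComponent, Submodule.mem_span_singleton]
    constructor
    · rintro ⟨f, hf, rfl⟩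
      obtain ⟨c, rfl⟩ : ∃ c, f = C c := ⟨_, (totalDegree_eq_zero_iff_eq_C.1
        ((totalDegree_zero_iff_isHomogeneous _).2 hf))⟩
      exact ⟨c, by rw [C_eq_smul_one]; rfl⟩
    · rintro ⟨c, rfl⟩
      exact ⟨C c, isHomogeneous_C _ _, by rw [C_eq_smul_one]; rfl⟩
  rw [this]
  have : Nontrivial (MvPolynomial (Fin (n + 1)) K ⧸ X.ideal) :=
    Ideal.Quotient.nontrivial_iff.2 X.ideal_ne_top
  exact_mod_cast finrank_span_singleton (one_ne_zero)

end ZeroDimScheme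

end GradedPieces

/-! ### The exact sequence for Ω¹_R and the Hilbert function formula -/

section Differentials

open KaehlerDifferential TensorProduct

variable {K : Type*} [Field K] {n : ℕ}

/-- Exactness of I/I² → (A/I) ⊗ Ω_A → Ω_{A/I}: the class 1 ⊗ ω comes from some f ∈ I, so 1 ⊗ ω = 1 ⊗
df. Stating this through functionals `L` lets coordinates be read off modulo I. -/
theorem exists_mem_of_map_quotient_eq_zero {A : Type*} [CommRing A] [Algebra K A] (I : Ideal A)
    (ω : Ω[A⁄K]) (h : map K K A (A ⧸ I) ω = 0) :
    ∃ f ∈ I, ∀ L : Ω[A⁄K] →ₗ[A] A, L ω - L (D K A f) ∈ I := by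
  have hx : mapBaseChange K A (A ⧸ I) (1 ⊗ₜ ω) = 0 := by
    rw [mapBaseChange_tmul, h, smul_zero]
  obtain ⟨y, hy⟩ := (exact_kerCotangentToTensor_mapBaseChange K A (A ⧸ I)
    Ideal.Quotient.mk_surjective _).1 hx
  obtain ⟨⟨f, hf⟩, rfl⟩ := Ideal.toCotangent_surjective _ y
  rw [kerCotangentToTensor_toCotangent] at hy
  have hfI : f ∈ I := by
    rw [RingHom.mem_ker] at hf
    exact Ideal.Quotient.eq_zero_iff_mem.1 hf
  refine ⟨f, hfI, fun L => ?_⟩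
  have := congrArg (TensorProduct.rid A (A ⧸ I) ∘ LinearMap.lTensor (A ⧸ I) L) hy
  simp only [Function.comp_apply, LinearMap.lTensor_tmul, TensorProduct.rid_tmul] at this
  rw [← Ideal.Quotient.eq_zero_iff_mem, map_sub, sub_eq_zero, eq_comm]
  simpa [Algebra.smul_def] using this

theorem exists_mem_of_sum_smul_D_eq_zero (I : Ideal (MvPolynomial (Fin (n + 1)) K))
    (h : Fin (n + 1) → MvPolynomial (Fin (n + 1)) K)
    (h0 : ∑ k, Ideal.Quotient.mk I (h k) •
      D K (MvPolynomial (Fin (n + 1)) K ⧸ I) (Ideal.Quotient.mk I (X k)) = 0) :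
    ∃ f ∈ I, ∀ k, h k - pderiv k f ∈ I := by
  obtain ⟨f, hf, hL⟩ := exists_mem_of_map_quotient_eq_zero (K := K) I
    (∑ k, h k • D K (MvPolynomial (Fin (n + 1)) K) (X k)) (by
      rw [← h0, map_sum]
      refine Finset.sum_congr rfl fun k _ => ?_
      rw [map_smul, map_D]
      rfl)
  refine ⟨f, hf, fun k => ?_⟩
  -- The functional induced by ∂/∂X_k extracts the coefficient of dX_k.
  have := hL (pderiv k).liftKaehlerDifferential
  simpa [pderiv_X, Pi.single_apply] using this

section Abstract

variable {A ι : Type*} [CommRing A] [Algebra K A] [Fintype ι]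

/-- The map `(h_k) ↦ ∑ h_k dx_k`. -/
def sumSmulD (x : ι → A) : (ι → A) →ₗ[K] Ω[A⁄K] where
  toFun h := ∑ k, h k • D K A (x k)
  map_add' h h' := by simp [add_smul, Finset.sum_add_distrib]
  map_smul' c h := by simp [Finset.smul_sum]

theorem sumSmulD_apply (x h : ι → A) : sumSmulD (K := K) x h = ∑ k, h k • D K A (x k) := rfl

theorem smul_D_eq_zero_left {f : A} (hf : f = 0) (g : A) : f • D K A g = 0 := by
  rw [hf, zero_smul]

theorem smul_D_eq_zero_right (f : A) {g : A} (hg : D K A g = 0) : f • D K A g = 0 := by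
  rw [hg, smul_zero]

theorem smul_D_eq_sumSmulD {x h : ι → A} {g : A} (hg : D K A g = ∑ k, h k • D K A (x k)) (f : A) :
    f • D K A g = sumSmulD (K := K) x (fun k => f * h k) := by
  rw [hg, sumSmulD_apply, Finset.smul_sum]
  simp [mul_smul]

end Abstract

theorem D_mk_eq_sum (I : Ideal (MvPolynomial (Fin (n + 1)) K))
    (f : MvPolynomial (Fin (n + 1)) K) :
    D K (MvPolynomial (Fin (n + 1)) K ⧸ I) (Ideal.Quotient.mk I f) =
      ∑ k, Ideal.Quotient.mk I (pderiv k f) •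
        D K (MvPolynomial (Fin (n + 1)) K ⧸ I) (Ideal.Quotient.mk I (X k)) := by
  have h : D K (MvPolynomial (Fin (n + 1)) K) f =
      ∑ k, pderiv k f • D K (MvPolynomial (Fin (n + 1)) K) (X k) := by
    have := (mvPolynomialBasis K (Fin (n + 1))).sum_repr (D K (MvPolynomial (Fin (n + 1)) K) f)
    simpa using this.symm
  have := congrArg (map K K (MvPolynomial (Fin (n + 1)) K) (MvPolynomial (Fin (n + 1)) K ⧸ I)) h
  rw [map_D, map_sum] at this
  refine Eq.trans this (Finset.sum_congr rfl fun k _ => ?_)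
  rw [map_smul, map_D]
  rfl

namespace ZeroDimScheme

variable (X : ZeroDimScheme K n)

theorem kaehlerComponent_of_le_zero {i : ℤ} (hi : i ≤ 0) : X.kaehlerComponent i = ⊥ := by
  rw [kaehlerComponent, Submodule.span_eq_bot]
  rintro ω ⟨a, b, hab, f, hf, g, hg, rfl⟩
  rcases lt_or_ge a 0 with ha | ha
  · rw [X.coordComponent_of_neg ha, Submodule.mem_bot] at hf
    exact smul_D_eq_zero_left hf _
  rcases lt_or_ge b 0 with hb | hb
  · rw [X.coordComponent_of_neg hb, Submodule.mem_bot] at hg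
    exact smul_D_eq_zero_right _ (by rw [hg, map_zero])
  -- Nonnegative degrees with sum at most 0 force g to be a constant, and then dg = 0.
  obtain rfl : b = 0 := by omega
  obtain ⟨G, hG, rfl⟩ := hg
  obtain ⟨c, rfl⟩ : ∃ c, G = C c := ⟨_, (totalDegree_eq_zero_iff_eq_C.1
        ((totalDegree_zero_iff_isHomogeneous _).2 hG))⟩
  have : (Ideal.Quotient.mkₐ K X.ideal).toLinearMap (C c) = algebraMap K X.coordRing c := rfl
  exact smul_D_eq_zero_right _ (by rw [this, Derivation.map_algebraMap])

theorem HFOmega_of_le_zero {i : ℤ} (hi : i ≤ 0) : X.HFOmega i = 0 := by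
  rw [HFOmega, hilbertFun, X.kaehlerComponent_of_le_zero hi, finrank_bot, Nat.cast_zero]

/-- The restriction of `sumSmulD` to tuples of elements of degree `d`. -/
def sumSmulDComponent (d : ℕ) : (Fin (n + 1) → quotComponent X.ideal d) →ₗ[K] Ω[X.coordRing⁄K] :=
  sumSmulD (fun k => Ideal.Quotient.mk X.ideal (MvPolynomial.X k)) ∘ₗ
    (LinearMap.pi fun k => (quotComponent X.ideal d).subtype ∘ₗ LinearMap.proj k)

theorem sumSmulDComponent_apply (d : ℕ) (h : Fin (n + 1) → quotComponent X.ideal d) :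
    X.sumSmulDComponent d h =
      ∑ k, (h k : X.coordRing) • D K X.coordRing (Ideal.Quotient.mk X.ideal (MvPolynomial.X k)) :=
  rfl

theorem range_sumSmulDComponent (d : ℕ) :
    LinearMap.range (X.sumSmulDComponent d) = X.kaehlerComponent (d + 1) := by
  apply le_antisymm
  · rintro _ ⟨h, rfl⟩
    rw [sumSmulDComponent_apply]
    refine Submodule.sum_mem _ fun k _ => Submodule.subset_span ?_
    exact ⟨d, 1, rfl, h k, (h k).2, _, mk_mem_quotComponent X.ideal (isHomogeneous_X K k), rfl⟩
  · rw [kaehlerComponent, Submodule.span_le]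
    rintro ω ⟨a, b, hab, f, hf, g, hg, rfl⟩
    rcases lt_or_ge a 0 with ha | ha
    · rw [X.coordComponent_of_neg ha, Submodule.mem_bot] at hf
      exact (smul_D_eq_zero_left (K := K) hf g).symm ▸ zero_mem _
    rcases lt_or_ge b 0 with hb | hb
    · rw [X.coordComponent_of_neg hb, Submodule.mem_bot] at hg
      exact (smul_D_eq_zero_right (K := K) f (g := g) (by rw [hg, map_zero])).symm ▸ zero_mem _
    lift a to ℕ using ha
    lift b to ℕ using hb
    obtain ⟨F, hF, rfl⟩ := hf
    obtain ⟨G, hG, rfl⟩ := hg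
    have key : ∀ k, (F * pderiv k G).IsHomogeneous d := by
      intro k
      -- For b = 0 the degree b - 1 would truncate; there G is a constant and its derivatives
      -- vanish.
      rcases Nat.eq_zero_or_pos b with rfl | hb
      · obtain ⟨c, rfl⟩ : ∃ c, G = C c := ⟨_, (totalDegree_eq_zero_iff_eq_C.1
          ((totalDegree_zero_iff_isHomogeneous _).2 hG))⟩
        rw [pderiv_C, mul_zero]
        exact isHomogeneous_zero _ _ _
      · have := IsHomogeneous.mul hF (IsHomogeneous.pderiv (i := k) hG)
        rwa [show a + (b - 1) = d by omega] at this
    refine ⟨fun k => ⟨_, mk_mem_quotComponent X.ideal (key k)⟩, ?_⟩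
    have e : (fun k => Ideal.Quotient.mk X.ideal (F * pderiv k G)) =
        fun k => Ideal.Quotient.mk X.ideal F * Ideal.Quotient.mk X.ideal (pderiv k G) :=
      funext fun k => map_mul (Ideal.Quotient.mk X.ideal) F (pderiv k G)
    have h1 := smul_D_eq_sumSmulD (D_mk_eq_sum X.ideal G) (Ideal.Quotient.mk X.ideal F)
    rw [← e] at h1
    exact h1.symm

/-- The gradient map from the forms of degree `d + 1` in the ideal to tuples of degree `d`. -/
def gradComponent (d : ℕ) :
    idealComponent X.ideal (d + 1) →ₗ[K] (Fin (n + 1) → quotComponent X.ideal d) :=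
  LinearMap.pi fun k =>
    { toFun f := ⟨Ideal.Quotient.mk X.ideal (pderiv k f.1.1),
        mk_mem_quotComponent X.ideal (IsHomogeneous.pderiv f.1.2)⟩
      map_add' f g := by ext; simp
      map_smul' c f := by
        apply Subtype.ext
        exact congrArg (Ideal.Quotient.mk X.ideal) ((pderiv k).map_smul c f.1.1) }

/-- One inclusion is df = ∑ (∂f/∂X_k) dx_k = 0 in Ω¹_R for f ∈ I_𝕏. Conversely, a relation ∑ h_k
dx_k = 0 is the gradient of some f ∈ I_𝕏 modulo I_𝕏, and homogeneity of I_𝕏 allows f to be replaced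
by its component of degree d + 1. -/
theorem range_gradComponent (d : ℕ) :
    LinearMap.range (X.gradComponent d) = LinearMap.ker (X.sumSmulDComponent d) := by
  apply le_antisymm
  · rintro _ ⟨f, rfl⟩
    rw [LinearMap.mem_ker, sumSmulDComponent_apply]
    refine (D_mk_eq_sum X.ideal f.1.1).symm.trans ?_
    exact (congrArg _ (Ideal.Quotient.eq_zero_iff_mem.2 f.2)).trans (map_zero _)
  · intro h hh
    rw [LinearMap.mem_ker, sumSmulDComponent_apply] at hh
    choose H hH hHh using fun k => mem_quotComponent.1 (h k).2
    simp only [← hHh] at hh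
    obtain ⟨f, hf, hfH⟩ := exists_mem_of_sum_smul_D_eq_zero X.ideal H hh
    refine ⟨⟨⟨homogeneousComponent (d + 1) f, homogeneousComponent_isHomogeneous _ _⟩,
      X.homogeneous f hf _⟩, ?_⟩
    funext k
    apply Subtype.ext
    rw [← hHh, eq_comm]
    refine (Ideal.Quotient.mk_eq_mk_iff_sub_mem _ _).2 ?_
    have := X.homogeneous _ (hfH k) d
    rwa [map_sub, homogeneousComponent_pderiv, homogeneousComponent_eq_self (hH k)] at this

theorem finrank_ker_gradComponent (d : ℕ) :
    Module.finrank K (LinearMap.ker (X.gradComponent d)) =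
      Module.finrank K (idealComponent X.diffFattening.ideal (d + 1)) := by
  have hle : idealComponent X.diffFattening.ideal (d + 1) ≤ idealComponent X.ideal (d + 1) :=
    fun f hf => ((mem_diffPower_two_iff _ _).1 hf).1
  have : LinearMap.ker (X.gradComponent d) =
      (idealComponent X.diffFattening.ideal (d + 1)).comap
        (idealComponent X.ideal (d + 1)).subtype := by
    ext f
    have h1 : f ∈ LinearMap.ker (X.gradComponent d) ↔ ∀ k, pderiv k f.1.1 ∈ X.ideal := by
      rw [LinearMap.mem_ker, funext_iff]
      refine forall_congr' fun k => ?_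
      rw [Subtype.ext_iff]
      exact Ideal.Quotient.eq_zero_iff_mem
    rw [h1]
    exact ⟨fun h => (mem_diffPower_two_iff _ _).2 ⟨f.2, h⟩,
      fun h => ((mem_diffPower_two_iff _ _).1 h).2⟩
  rw [this]
  exact (Submodule.comapSubtypeEquivOfLe hle).finrank_eq

/-- Rank-nullity for the two maps of the exact sequence; the dimensions of the ideal pieces are
traded for those of the quotients, and the dimension of P_{d+1} cancels. -/
theorem HFOmega_succ (d : ℕ) :
    X.HFOmega (d + 1) = (n + 1) * X.HF d + X.HF (d + 1) - X.diffFattening.HF (d + 1) := by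
  have h1 := LinearMap.finrank_range_add_finrank_ker (X.sumSmulDComponent d)
  have h2 := LinearMap.finrank_range_add_finrank_ker (K := K)
    (V := idealComponent X.ideal (d + 1)) (V₂ := Fin (n + 1) → quotComponent X.ideal d)
    (X.gradComponent d)
  rw [Module.finrank_pi_fintype, Finset.sum_const, Finset.card_univ, Fintype.card_fin,
    smul_eq_mul, range_sumSmulDComponent, ← range_gradComponent] at h1
  rw [finrank_ker_gradComponent] at h2
  have h3 := finrank_quotComponent_add X.ideal (d + 1)
  have h4 := finrank_quotComponent_add X.diffFattening.ideal (d + 1)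
  have e1 : X.HFOmega (d + 1) = Module.finrank K (X.kaehlerComponent (d + 1)) := rfl
  have e2 := X.HF_natCast (d + 1)
  have e3 := X.diffFattening.HF_natCast (d + 1)
  push_cast at e2 e3
  rw [e1, e2, e3, HF_natCast]
  zify at h1 h2 h3 h4
  linarith

theorem HFOmega_natCast (i : ℕ) :
    X.HFOmega i = (n + 1) * X.HF (i - 1) + X.HF i - X.diffFattening.HF i := by
  cases i with
  | zero =>
    -- In degree 0 the formula reads 0 = (n + 1) · 0 + 1 - 1.
    rw [Nat.cast_zero, X.HFOmega_of_le_zero le_rfl, X.HF_of_neg (by simp), HF_zero, HF_zero]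
    simp
  | succ d =>
    push_cast
    rw [HFOmega_succ, add_sub_cancel_right]

end ZeroDimScheme

end Differentials

/-! ### Monotonicity and linear growth of dimensions -/

section Growth

/-- A bounded monotone sequence of natural numbers is eventually constant. -/
theorem Monotone.exists_eventually_eq_of_le {h : ℕ → ℕ} (hm : Monotone h) {B : ℕ}
    (hB : ∀ d, h d ≤ B) : ∃ N, ∀ d ≥ N, h d = h N := by
  have hbdd : BddAbove (Set.range h) := ⟨B, by rintro _ ⟨d, rfl⟩; exact hB d⟩
  obtain ⟨N, hN⟩ := Nat.sSup_mem (Set.range_nonempty h) hbdd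
  refine ⟨N, fun d hd => le_antisymm ?_ (hm hd)⟩
  rw [hN]
  exact le_csSup hbdd ⟨d, rfl⟩

/-- A monotone sequence of natural numbers whose partial sums grow linearly is bounded. -/
theorem Monotone.le_of_sum_range_le {h : ℕ → ℕ} (hm : Monotone h) {a b : ℕ}
    (hs : ∀ d, ∑ i ∈ Finset.range d, h i ≤ a + b * d) (d : ℕ) : h d ≤ a + 2 * b := by
  rcases Nat.eq_zero_or_pos d with rfl | hd
  · have := hs 1
    simp at this
    omega
  -- Each of the d terms with index in [d, 2d) is at least h d, while their sum is at most a + 2bd.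
  have h1 : d * h d ≤ ∑ i ∈ Finset.Ico d (2 * d), h i := by
    have := Finset.card_nsmul_le_sum (Finset.Ico d (2 * d)) h (h d)
      (fun i hi => hm (Finset.mem_Ico.1 hi).1)
    rw [Nat.card_Ico, smul_eq_mul] at this
    rwa [show 2 * d - d = d by omega] at this
  have h2 : ∑ i ∈ Finset.Ico d (2 * d), h i ≤ ∑ i ∈ Finset.range (2 * d), h i := by
    refine Finset.sum_le_sum_of_subset fun i hi => ?_
    rw [Finset.mem_range]
    exact (Finset.mem_Ico.1 hi).2
  have h3 := (h1.trans h2).trans (hs (2 * d))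
  refine Nat.le_of_mul_le_mul_left (h3.trans ?_) hd
  nlinarith

variable {K A : Type*} [Field K] [CommRing A] [Algebra K A]

/-- If no nonzero element of `A` is annihilated by all `x k`, then multiplication by the generic
linear combination of the `x k` is injective, so that dimensions do not decrease. -/
theorem finrank_le_finrank_of_mul_mem {n : ℕ} (x : Fin (n + 1) → A)
    (hx : ∀ a, (∀ k, a * x k = 0) → a = 0) (V W : Submodule K A) [Module.Finite K V]
    [Module.Finite K W] (hVW : ∀ k, ∀ v ∈ V, x k * v ∈ W) :
    Module.finrank K V ≤ Module.finrank K W := by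
  let l : Polynomial A := ∑ k : Fin (n + 1), Polynomial.monomial (k : ℕ) (x k)
  have hlc : ∀ k : Fin (n + 1), l.coeff k = x k := by
    intro k
    simp [l, Polynomial.finsetSum_coeff, Polynomial.coeff_monomial, Fin.val_inj]
  have hlc' : ∀ m, n + 1 ≤ m → l.coeff m = 0 := by
    intro m hm
    simp only [l, Polynomial.finsetSum_coeff, Polynomial.coeff_monomial]
    exact Finset.sum_eq_zero fun k _ => if_neg (by omega)
  -- McCoy's theorem: only constants have to be tested as annihilators of `l`.
  have hl : l ∈ nonZeroDivisors (Polynomial A) := by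
    rw [Polynomial.mem_nonZeroDivisors_iff]
    intro a ha
    refine hx a fun k => ?_
    have := congrArg (fun p => Polynomial.coeff p k) ha
    simpa [hlc] using this
  have hmem : ∀ q : Polynomial A, (∀ j, q.coeff j ∈ V) → ∀ m, (l * q).coeff m ∈ W := by
    intro q hq m
    rw [Polynomial.coeff_mul]
    refine Submodule.sum_mem _ fun ij _ => ?_
    rcases lt_or_ge ij.1 (n + 1) with h | h
    · have := hVW ⟨ij.1, h⟩ _ (hq ij.2)
      rwa [← hlc] at this
    · rw [hlc' _ h, zero_mul]
      exact zero_mem _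
  -- Multiplication by `l` embeds the polynomials of degree < N with coefficients in V into those of
  -- degree < N + n + 1 with coefficients in W.
  have key : ∀ N : ℕ, N * Module.finrank K V ≤ (N + (n + 1)) * Module.finrank K W := by
    intro N
    let S : (Fin N → V) →ₗ[K] Polynomial A :=
      ∑ j : Fin N, ((Polynomial.monomial (R := A) (j : ℕ)).restrictScalars K) ∘ₗ V.subtype ∘ₗ
        LinearMap.proj j
    have hS : ∀ f, S f = ∑ j : Fin N, Polynomial.monomial (j : ℕ) (f j : A) := by
      intro f
      simp [S]
    have hSc : ∀ f m, (S f).coeff m ∈ V := by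
      intro f m
      rw [hS, Polynomial.finsetSum_coeff]
      refine Submodule.sum_mem _ fun j _ => ?_
      rw [Polynomial.coeff_monomial]
      split_ifs
      · exact (f j).2
      · exact zero_mem _
    have hScj : ∀ f (j : Fin N), (S f).coeff j = f j := by
      intro f j
      simp [hS, Polynomial.finsetSum_coeff, Polynomial.coeff_monomial, Fin.val_inj]
    let T : (Fin N → V) →ₗ[K] (Fin (N + (n + 1)) → W) :=
      LinearMap.pi fun m => LinearMap.codRestrict W
        (((Polynomial.lcoeff A (m : ℕ)).restrictScalars K) ∘ₗ
          (LinearMap.mulLeft K l) ∘ₗ S) (fun f => hmem _ (hSc f) _)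
    have hT : Function.Injective T := by
      rw [← LinearMap.ker_eq_bot, LinearMap.ker_eq_bot']
      intro f hf
      have h0 : l * S f = 0 := by
        ext m
        rw [Polynomial.coeff_zero]
        rcases lt_or_ge m (N + (n + 1)) with h | h
        · exact congrArg Subtype.val (congrFun hf ⟨m, h⟩)
        · rw [Polynomial.coeff_mul]
          refine Finset.sum_eq_zero fun ij hij => ?_
          have hij := Finset.HasAntidiagonal.mem_antidiagonal.1 hij
          rcases lt_or_ge ij.1 (n + 1) with h' | h'
          · have : (S f).coeff ij.2 = 0 := by
              rw [hS, Polynomial.finsetSum_coeff]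
              refine Finset.sum_eq_zero fun j _ => ?_
              rw [Polynomial.coeff_monomial, if_neg (by omega)]
            rw [this, mul_zero]
          · rw [hlc' _ h', zero_mul]
      have h1 : S f = 0 := by
        rw [mul_comm] at h0
        exact (mem_nonZeroDivisors_iff.1 hl).2 _ h0
      funext j
      apply Subtype.ext
      rw [← hScj, h1]
      simp
    have := LinearMap.finrank_le_finrank_of_injective hT
    simpa [Module.finrank_pi_fintype] using this
  by_contra hlt
  push Not at hlt
  -- If dim V ≥ dim W + 1, then `key` would give N ≤ (n + 1) dim W; this N is the first to violate
  -- it.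
  have h1 := key ((n + 1) * Module.finrank K W + 1)
  have h2 := Nat.mul_le_mul_left ((n + 1) * Module.finrank K W + 1) (Nat.succ_le_of_lt hlt)
  have h3 := h2.trans h1
  rw [Nat.succ_eq_add_one, mul_add, add_mul _ (n + 1)] at h3
  omega

/-- Lying over lifts the smallest prime of a chain in B, and going up lifts the rest. -/
theorem ringKrullDim_le_of_isIntegral {B C : Type*} [CommRing B] [CommRing C] [Algebra B C]
    [Algebra.IsIntegral B C] (hinj : Function.Injective (algebraMap B C)) :
    ringKrullDim B ≤ ringKrullDim C := by
  refine iSup_le fun l => ?_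
  obtain ⟨Q, -, hQ, hQl⟩ := Ideal.exists_ideal_over_prime_of_isIntegral
    (S := C) l.head.asIdeal ⊥ (by
      have := (RingHom.injective_iff_ker_eq_bot _).1 hinj
      rw [RingHom.ker] at this
      rw [this]
      exact bot_le)
  have : Q.LiesOver l.head.asIdeal := ⟨hQl.symm⟩
  obtain ⟨L, hL, -⟩ := Ideal.exists_ltSeries_of_hasGoingUp l Q
  rw [← hL]
  exact le_iSup (fun p : LTSeries (PrimeSpectrum C) => (p.length : WithBot ℕ∞)) L

/-- A finitely generated algebra of Krull dimension one is finite over some `K[y]`. -/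
theorem exists_forall_eq_sum_aeval_mul [Algebra.FiniteType K A] (hA : ringKrullDim A ≤ 1)
    [Nontrivial A] :
    ∃ (y : A) (k : ℕ) (g : Fin k → A), ∀ r : A, ∃ p : Fin k → Polynomial K,
      r = ∑ j, Polynomial.aeval y (p j) * g j := by
  obtain ⟨s, φ, hinj, hfin⟩ := exists_finite_inj_algHom_of_fg K A
  algebraize [φ.toRingHom]
  -- The normalization K[X_1, …, X_s] has dimension s, which cannot exceed the dimension of A.
  have hs : s ≤ 1 := by
    have hint : Algebra.IsIntegral (MvPolynomial (Fin s) K) A := ⟨hfin.to_isIntegral⟩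
    have hle := (ringKrullDim_le_of_isIntegral (B := MvPolynomial (Fin s) K) hinj).trans hA
    rw [ringKrullDim_of_isNoetherianRing, ringKrullDim_eq_zero_of_field, Nat.card_fin,
      zero_add] at hle
    exact_mod_cast hle
  obtain ⟨y, hy⟩ : ∃ y, ∀ i, φ (X i) = y := by
    rcases Nat.le_one_iff_eq_zero_or_eq_one.1 hs with rfl | rfl
    -- Without variables the choice of y is immaterial.
    · exact ⟨0, fun i => i.elim0⟩
    · exact ⟨φ (X 0), fun i => by rw [Subsingleton.elim i 0]⟩
  have hq : ∀ q, ∃ p : Polynomial K, φ q = Polynomial.aeval y p := by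
    intro q
    induction q using MvPolynomial.induction_on with
    | C a => exact ⟨Polynomial.C a, by simp [← algebraMap_eq]⟩
    | add p q hp hq =>
      obtain ⟨p', hp⟩ := hp
      obtain ⟨q', hq⟩ := hq
      exact ⟨p' + q', by simp [hp, hq]⟩
    | mul_X p i hp =>
      obtain ⟨p', hp⟩ := hp
      exact ⟨p' * Polynomial.X, by simp [hp, hy]⟩
  have hmf : Module.Finite (MvPolynomial (Fin s) K) A := hfin
  obtain ⟨k, g, hg⟩ := Module.Finite.exists_fin (R := MvPolynomial (Fin s) K) (M := A)
  refine ⟨y, k, g, fun r => ?_⟩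
  have hr : r ∈ Submodule.span (MvPolynomial (Fin s) K) (Set.range g) := by simp [hg]
  obtain ⟨c, hc⟩ := (Submodule.mem_span_range_iff_exists_fun _).1 hr
  choose p hp using fun j => hq (c j)
  refine ⟨p, ?_⟩
  rw [← hc]
  refine Finset.sum_congr rfl fun j _ => ?_
  rw [← hp, Algebra.smul_def]
  rfl

/-- The elements `∑ p_j(y) g_j` with polynomials `p_j` of degree less than `m`. -/
def aevalSpan {k : ℕ} (y : A) (g : Fin k → A) (m : ℕ) : Submodule K A :=
  LinearMap.range (∑ j : Fin k, LinearMap.mulRight K (g j) ∘ₗ (Polynomial.aeval y).toLinearMap ∘ₗ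
    (Polynomial.degreeLT K m).subtype ∘ₗ LinearMap.proj j :
      (Fin k → Polynomial.degreeLT K m) →ₗ[K] A)

theorem mem_aevalSpan {k : ℕ} {y : A} {g : Fin k → A} {m : ℕ} {a : A} :
    a ∈ aevalSpan (K := K) y g m ↔ ∃ p : Fin k → Polynomial K,
      (∀ j, p j ∈ Polynomial.degreeLT K m) ∧ a = ∑ j, Polynomial.aeval y (p j) * g j := by
  constructor
  · rintro ⟨p, rfl⟩
    exact ⟨fun j => p j, fun j => (p j).2, by simp⟩
  · rintro ⟨p, hp, rfl⟩
    exact ⟨fun j => ⟨p j, hp j⟩, by simp⟩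

instance {k : ℕ} (m : ℕ) : Module.Finite K (Fin k → Polynomial.degreeLT K m) := by
  have : Module.Finite K (Polynomial.degreeLT K m) :=
    Module.Finite.equiv (Polynomial.degreeLTEquiv K m).symm
  infer_instance

instance {k : ℕ} (y : A) (g : Fin k → A) (m : ℕ) : Module.Finite K (aevalSpan (K := K) y g m) := by
  unfold aevalSpan; infer_instance

theorem finrank_aevalSpan_le {k : ℕ} (y : A) (g : Fin k → A) (m : ℕ) :
    Module.finrank K (aevalSpan (K := K) y g m) ≤ k * m := by
  have : Module.Finite K (Polynomial.degreeLT K m) :=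
    Module.Finite.equiv (Polynomial.degreeLTEquiv K m).symm
  refine (LinearMap.finrank_range_le _).trans ?_
  rw [Module.finrank_pi_fintype, (Polynomial.degreeLTEquiv K m).finrank_eq]
  simp

theorem aevalSpan_mono {k : ℕ} (y : A) (g : Fin k → A) {m m' : ℕ} (h : m ≤ m') :
    aevalSpan (K := K) y g m ≤ aevalSpan y g m' := by
  intro a ha
  obtain ⟨p, hp, rfl⟩ := mem_aevalSpan.1 ha
  exact mem_aevalSpan.2 ⟨p, fun j => Polynomial.degreeLT_mono h (hp j), rfl⟩

theorem exists_mem_aevalSpan {k : ℕ} {y : A} {g : Fin k → A} (hg : ∀ r : A,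
    ∃ p : Fin k → Polynomial K, r = ∑ j, Polynomial.aeval y (p j) * g j) (r : A) :
    ∃ m, r ∈ aevalSpan (K := K) y g m := by
  obtain ⟨p, hp⟩ := hg r
  -- The sum bounds all degrees at once; the extra 1 is there because `degreeLT` is strict.
  refine ⟨(∑ j, (p j).natDegree) + 1, mem_aevalSpan.2 ⟨p, fun j => ?_, hp⟩⟩
  rw [Polynomial.mem_degreeLT]
  refine lt_of_le_of_lt Polynomial.degree_le_natDegree ?_
  have := Finset.single_le_sum (f := fun j => (p j).natDegree) (fun _ _ => Nat.zero_le _)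
    (Finset.mem_univ j)
  exact_mod_cast Nat.lt_succ_of_le this

/-- The products x g_j are finitely many, so multiplication by x shifts the filtration by a constant
independent of m. -/
theorem exists_mul_mem_aevalSpan {k : ℕ} {y : A} {g : Fin k → A} (hg : ∀ r : A,
    ∃ p : Fin k → Polynomial K, r = ∑ j, Polynomial.aeval y (p j) * g j) (x : A) :
    ∃ c, ∀ m, ∀ a ∈ aevalSpan (K := K) y g m, x * a ∈ aevalSpan (K := K) y g (m + c) := by
  choose c hc using fun j => exists_mem_aevalSpan hg (x * g j)
  refine ⟨∑ j, c j, fun m a ha => ?_⟩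
  obtain ⟨p, hp, rfl⟩ := mem_aevalSpan.1 ha
  rw [Finset.mul_sum]
  refine Submodule.sum_mem _ fun j _ => ?_
  have hcj : c j ≤ ∑ j, c j := Finset.single_le_sum (fun _ _ => Nat.zero_le _) (Finset.mem_univ j)
  refine aevalSpan_mono y g (Nat.add_le_add_left hcj m) ?_
  obtain ⟨q, hq, hxq⟩ := mem_aevalSpan.1 (hc j)
  refine mem_aevalSpan.2 ⟨fun i => p j * q i, fun i => ?_, ?_⟩
  · rw [Polynomial.mem_degreeLT]
    have h1 := Polynomial.mem_degreeLT.1 (hp j)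
    have h2 := Polynomial.mem_degreeLT.1 (hq i)
    beta_reduce
    by_cases hp0 : p j = 0
    · rw [hp0, zero_mul, Polynomial.degree_zero]
      exact WithBot.bot_lt_coe _
    by_cases hq0 : q i = 0
    · rw [hq0, mul_zero, Polynomial.degree_zero]
      exact WithBot.bot_lt_coe _
    rw [Polynomial.degree_mul]
    rw [Polynomial.degree_eq_natDegree hp0] at h1 ⊢
    rw [Polynomial.degree_eq_natDegree hq0] at h2 ⊢
    norm_cast at h1 h2 ⊢
    omega
  · rw [mul_left_comm, hxq, Finset.mul_sum]
    refine Finset.sum_congr rfl fun i _ => ?_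
    rw [map_mul, mul_assoc]

/-- The dimensions of a graded algebra that is finite over some `K[y]` have linear growth. -/
theorem exists_finrank_le_of_generated {n : ℕ} (x : Fin (n + 1) → A) {k : ℕ} {y : A} {g : Fin k → A}
    (hg : ∀ r : A, ∃ p : Fin k → Polynomial K, r = ∑ j, Polynomial.aeval y (p j) * g j) :
    ∃ a b, ∀ f : MvPolynomial (Fin (n + 1)) K, ∀ d, f.IsHomogeneous d →
      aeval x f ∈ aevalSpan (K := K) y g (a + b * d) := by
  obtain ⟨a, ha⟩ := exists_mem_aevalSpan hg 1
  -- A monomial of degree d is reached from 1 by d multiplications by variables, each costing at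
  -- most ∑ c_i.
  choose c hc using fun i => exists_mul_mem_aevalSpan hg (x i)
  refine ⟨a, ∑ i, c i, fun f d hf => ?_⟩
  have key : ∀ d, ∀ e : Fin (n + 1) →₀ ℕ, e.degree = d → ∀ t : K,
      aeval x (monomial e t) ∈ aevalSpan (K := K) y g (a + (∑ i, c i) * d) := by
    intro d
    induction d with
    | zero =>
      intro e he t
      obtain rfl : e = 0 := (Finsupp.degree_eq_zero_iff e).1 he
      rw [aeval_monomial, Finsupp.prod_zero_index, ← Algebra.smul_def]
      exact Submodule.smul_mem _ _ ha
    | succ d ih =>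
      intro e he t
      obtain ⟨i, hi⟩ : ∃ i, e i ≠ 0 := by
        by_contra! h
        obtain rfl : e = 0 := Finsupp.ext h
        simp at he
      have hle : Finsupp.single i 1 ≤ e := by
        rw [Finsupp.single_le_iff]
        omega
      have hsum := tsub_add_cancel_of_le hle
      have hdeg := congrArg Finsupp.degree hsum
      rw [map_add, Finsupp.degree_single, he] at hdeg
      have := hc i _ _ (ih (e - Finsupp.single i 1) (by omega) t)
      have hX : x i * aeval x (monomial (e - Finsupp.single i 1) t) = aeval x (monomial e t) := by
        rw [← aeval_X (R := K) x i, ← map_mul, X, monomial_mul, one_mul,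
          add_comm (Finsupp.single i 1), hsum]
      rw [hX] at this
      refine aevalSpan_mono y g ?_ this
      have := Finset.single_le_sum (f := c) (fun _ _ => Nat.zero_le _) (Finset.mem_univ i)
      rw [mul_add]
      omega
  rw [f.as_sum, map_sum]
  refine Submodule.sum_mem _ fun e he => key d e ?_ _
  exact (hf.degree_eq_sum_deg_support he).symm

end Growth

/-! ### Eventual constancy of HF_𝕏 -/

section HilbertFunction

variable {K : Type*} [Field K] {n : ℕ}

namespace ZeroDimScheme

variable (X : ZeroDimScheme K n)

theorem finrank_quotComponent_mono :
    Monotone fun d => Module.finrank K (quotComponent X.ideal d) := by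
  refine monotone_nat_of_le_succ fun d => ?_
  refine finrank_le_finrank_of_mul_mem
    (fun k => Ideal.Quotient.mk X.ideal (MvPolynomial.X k)) ?_ _ _ ?_
  · intro a ha
    obtain ⟨f, rfl⟩ := Ideal.Quotient.mk_surjective a
    refine Ideal.Quotient.eq_zero_iff_mem.2 (X.saturated f fun k => ?_)
    rw [← Ideal.Quotient.eq_zero_iff_mem, mul_comm, map_mul]
    exact ha k
  · rintro k _ ⟨f, hf, rfl⟩
    have := mk_mem_quotComponent X.ideal (IsHomogeneous.mul (isHomogeneous_X K k) hf)
    rw [add_comm 1] at this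
    rwa [map_mul] at this

theorem exists_sum_range_le :
    ∃ a b, ∀ d, ∑ i ∈ Finset.range d, Module.finrank K (quotComponent X.ideal i) ≤ a + b * d := by
  have hnt : Nontrivial (MvPolynomial (Fin (n + 1)) K ⧸ X.ideal) :=
    Ideal.Quotient.nontrivial_iff.2 X.ideal_ne_top
  obtain ⟨y, k, g, hg⟩ := exists_forall_eq_sum_aeval_mul (K := K) X.dim_eq_one.le
  obtain ⟨a, b, hab⟩ := exists_finrank_le_of_generated
    (fun k => Ideal.Quotient.mk X.ideal (MvPolynomial.X k)) hg
  have hae : ∀ f, aeval (fun k => Ideal.Quotient.mk X.ideal (MvPolynomial.X k)) f =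
      Ideal.Quotient.mk X.ideal f := by
    intro f
    have : aeval (fun k => Ideal.Quotient.mk X.ideal (MvPolynomial.X k)) =
        Ideal.Quotient.mkₐ K X.ideal := by
      ext i
      simp
    rw [this]
    rfl
  refine ⟨k * a, k * b, fun d => ?_⟩
  have hmem : ∀ (i : Fin d) (v : quotComponent X.ideal i),
      (v : MvPolynomial (Fin (n + 1)) K ⧸ X.ideal) ∈ aevalSpan (K := K) y g (a + b * d) := by
    rintro i ⟨_, f, hf, rfl⟩
    refine aevalSpan_mono y g (Nat.add_le_add_left (Nat.mul_le_mul_left b i.2.le) a) ?_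
    have := hab f i hf
    rwa [hae] at this
  let T : (∀ i : Fin d, quotComponent X.ideal i) →ₗ[K] aevalSpan (K := K) y g (a + b * d) :=
    ∑ i : Fin d, (LinearMap.codRestrict _ (quotComponent X.ideal i).subtype (hmem i)) ∘ₗ LinearMap.proj i
  have hTv : ∀ v, ((T v : aevalSpan (K := K) y g (a + b * d)) :
      MvPolynomial (Fin (n + 1)) K ⧸ X.ideal) = ∑ i, (v i).1 := by
    intro v
    simp [T]
    rfl
  -- Since I_𝕏 is homogeneous, the pieces R_0, …, R_{d-1} are independent in R; all of them lie in
  -- one filtration step of dimension linear in d.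
  have hT : Function.Injective T := by
    rw [← LinearMap.ker_eq_bot, LinearMap.ker_eq_bot']
    intro v hv
    have h0 := hTv v
    rw [hv, Submodule.coe_zero] at h0
    choose F hF hFv using fun i => mem_quotComponent.1 (v i).2
    simp only [← hFv] at h0
    rw [← map_sum, eq_comm, Ideal.Quotient.eq_zero_iff_mem] at h0
    funext i
    apply Subtype.ext
    rw [← hFv, Pi.zero_apply, Submodule.coe_zero, Ideal.Quotient.eq_zero_iff_mem]
    have := X.homogeneous _ h0 i
    rw [map_sum, Finset.sum_eq_single i] at this
    · rwa [homogeneousComponent_eq_self (hF i)] at this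
    · intro j _ hj
      rw [homogeneousComponent_of_mem (hF j), if_neg]
      exact fun h => hj (Fin.ext h.symm)
    · simp
  have h1 := LinearMap.finrank_le_finrank_of_injective hT
  rw [Module.finrank_pi_fintype, Fin.sum_univ_eq_sum_range
    (fun i => Module.finrank K (quotComponent X.ideal i))] at h1
  refine (h1.trans (finrank_aevalSpan_le y g _)).trans (le_of_eq ?_)
  ring

/-- The Hilbert function of a zero-dimensional scheme is eventually constant and positive. -/
theorem exists_finrank_quotComponent_eq :
    ∃ D N : ℕ, 1 ≤ D ∧ ∀ d ≥ N, Module.finrank K (quotComponent X.ideal d) = D := by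
  obtain ⟨a, b, hab⟩ := X.exists_sum_range_le
  have hmono := X.finrank_quotComponent_mono
  obtain ⟨N, hN⟩ := hmono.exists_eventually_eq_of_le (hmono.le_of_sum_range_le hab)
  refine ⟨_, N, ?_, hN⟩
  refine le_trans ?_ (hmono (Nat.zero_le N))
  have := X.HF_zero
  rw [show (0 : ℤ) = ((0 : ℕ) : ℤ) from rfl, HF_natCast] at this
  exact_mod_cast this.ge

end ZeroDimScheme

end HilbertFunction

/-! ### Hilbert polynomials and regularity indices -/

section HilbertPolynomials

theorem IsHilbertPoly.hilbertPoly_eq {F : ℤ → ℤ} {q : Polynomial ℚ} (h : IsHilbertPoly F q) :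
    hilbertPoly F = q := by
  have hex : ∃ q, IsHilbertPoly F q := ⟨q, h⟩
  rw [hilbertPoly, dif_pos hex]
  obtain ⟨N, hN⟩ := h
  obtain ⟨M, hM⟩ := hex.choose_spec
  refine Polynomial.eq_of_infinite_eval_eq _ _ ?_
  refine Set.Infinite.mono (s := (fun i : ℤ => (i : ℚ)) '' Set.Ici (max N M)) ?_
    ((Set.Ici_infinite _).image Int.cast_injective.injOn)
  rintro _ ⟨i, hi, rfl⟩
  have hi' := max_le_iff.1 (Set.mem_Ici.1 hi)
  exact (hM i hi'.2).symm.trans (hN i hi'.1)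

/-- An infimum in ℤ is attained only for a nonempty set that is bounded below, hence the hypothesis
`hB`. -/
theorem IsHilbertPoly.isLeast_regularityIndex {F : ℤ → ℤ} {q : Polynomial ℚ}
    (h : IsHilbertPoly F q) {B : ℤ} (hB : ∀ i ∈ regularitySet F, B ≤ i) :
    IsLeast (regularitySet F) (regularityIndex F) := by
  have hne : (regularitySet F).Nonempty := by
    obtain ⟨N, hN⟩ := h
    refine ⟨N, fun j hj => ?_⟩
    rw [hN j hj, IsHilbertPoly.hilbertPoly_eq ⟨N, hN⟩]
  have hb : BddBelow (regularitySet F) := ⟨B, hB⟩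
  exact ⟨Int.csInf_mem hne hb, fun i hi => csInf_le hb hi⟩

namespace ZeroDimScheme

variable {K : Type*} [Field K] {n : ℕ} (X : ZeroDimScheme K n)

theorem isHilbertPoly_HF_of_eventually {D N : ℕ}
    (h : ∀ d ≥ N, Module.finrank K (quotComponent X.ideal d) = D) :
    IsHilbertPoly X.HF (Polynomial.C (D : ℚ)) := by
  refine ⟨N, fun i hi => ?_⟩
  lift i to ℕ using (Nat.cast_nonneg N).trans hi
  rw [HF_natCast, h i (by exact_mod_cast hi), Polynomial.eval_C]
  simp

theorem degree_eq_of_eventually {D N : ℕ}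
    (h : ∀ d ≥ N, Module.finrank K (quotComponent X.ideal d) = D) : X.degree = D := by
  rw [degree, (X.isHilbertPoly_HF_of_eventually h).hilbertPoly_eq, Polynomial.coeff_C_zero]

theorem isHilbertPoly_HF : IsHilbertPoly X.HF (Polynomial.C X.degree) := by
  obtain ⟨D, N, -, h⟩ := X.exists_finrank_quotComponent_eq
  rw [X.degree_eq_of_eventually h]
  exact X.isHilbertPoly_HF_of_eventually h

theorem degree_pos : 0 < X.degree := by
  obtain ⟨D, N, hD, h⟩ := X.exists_finrank_quotComponent_eq
  rw [X.degree_eq_of_eventually h]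
  exact_mod_cast hD

theorem HF_eq_of_mem_regularitySet {i j : ℤ} (hi : i ∈ regularitySet X.HF) (hj : i ≤ j) :
    (X.HF j : ℚ) = X.degree := by
  rw [hi j hj, X.isHilbertPoly_HF.hilbertPoly_eq, Polynomial.eval_C]

theorem nonneg_of_mem_regularitySet_HF {i : ℤ} (hi : i ∈ regularitySet X.HF) : 0 ≤ i := by
  by_contra! h
  have := X.HF_eq_of_mem_regularitySet hi le_rfl
  rw [X.HF_of_neg h, Int.cast_zero] at this
  exact X.degree_pos.ne this

theorem isLeast_regularityIndex_HF :
    IsLeast (regularitySet X.HF) (regularityIndex X.HF) :=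
  X.isHilbertPoly_HF.isLeast_regularityIndex fun _ => X.nonneg_of_mem_regularitySet_HF

theorem HFOmega_eq_of_mem {i j k : ℤ} (hi : i ∈ regularitySet X.HF)
    (hj : j ∈ regularitySet X.diffFattening.HF) (hik : i + 1 ≤ k) (hjk : j ≤ k) :
    (X.HFOmega k : ℚ) = (n + 2) * X.degree - X.diffFattening.degree := by
  have h0 := X.nonneg_of_mem_regularitySet_HF hi
  lift k to ℕ using by omega
  rw [X.HFOmega_natCast]
  push_cast
  rw [X.HF_eq_of_mem_regularitySet hi (by omega), X.HF_eq_of_mem_regularitySet hi (by omega),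
    X.diffFattening.HF_eq_of_mem_regularitySet hj hjk]
  ring

theorem isHilbertPoly_HFOmega :
    IsHilbertPoly X.HFOmega (Polynomial.C ((n + 2) * X.degree - X.diffFattening.degree)) := by
  refine ⟨max (regularityIndex X.HF + 1) (regularityIndex X.diffFattening.HF), fun k hk => ?_⟩
  rw [Polynomial.eval_C]
  exact X.HFOmega_eq_of_mem X.isLeast_regularityIndex_HF.1
    X.diffFattening.isLeast_regularityIndex_HF.1 (le_of_max_le_left hk) (le_of_max_le_right hk)

/-- In degree 1 the formula gives (n + 1) + HF_𝕏(1) - HF_𝕐(1), with HF_𝕏(1) ≥ 1 by monotonicity and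
HF_𝕐(1) ≤ n + 1. This excludes a function that is constant on all of ℤ, which would have no
regularity index. -/
theorem HFOmega_one_pos : 0 < X.HFOmega 1 := by
  have h := X.HFOmega_natCast 1
  rw [Nat.cast_one, sub_self, HF_zero] at h
  have h1 : 1 ≤ X.HF 1 := by
    have := X.finrank_quotComponent_mono zero_le_one
    exact X.HF_zero.symm.le.trans (Int.ofNat_le.2 this)
  have h2 : X.diffFattening.HF 1 ≤ n + 1 := by
    have h3 := finrank_quotComponent_add X.diffFattening.ideal 1
    have h4 : Module.finrank K (homogeneousSubmodule (Fin (n + 1)) K 1) ≤ n + 1 := by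
      rw [homogeneousSubmodule_one_eq_span_X]
      exact (finrank_range_le_card _).trans_eq (Fintype.card_fin _)
    have h5 : X.diffFattening.HF 1 =
      Module.finrank K (quotComponent X.diffFattening.ideal 1) := rfl
    omega
  omega

theorem isLeast_regularityIndex_HFOmega :
    IsLeast (regularitySet X.HFOmega) (regularityIndex X.HFOmega) := by
  refine X.isHilbertPoly_HFOmega.isLeast_regularityIndex (B := 0) fun i hi => ?_
  by_contra! h
  have h0 := hi i le_rfl
  have h1 := hi 1 (by omega)
  rw [X.isHilbertPoly_HFOmega.hilbertPoly_eq, Polynomial.eval_C] at h0 h1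
  rw [← h0, X.HFOmega_of_le_zero h.le] at h1
  have := X.HFOmega_one_pos
  norm_cast at h1
  omega

theorem regularityIndex_HFOmega_le :
    regularityIndex X.HFOmega ≤
      max (regularityIndex X.HF + 1) (regularityIndex X.diffFattening.HF) := by
  refine X.isLeast_regularityIndex_HFOmega.2 fun k hk => ?_
  rw [X.isHilbertPoly_HFOmega.hilbertPoly_eq, Polynomial.eval_C]
  exact X.HFOmega_eq_of_mem X.isLeast_regularityIndex_HF.1
    X.diffFattening.isLeast_regularityIndex_HF.1 (le_of_max_le_left hk) (le_of_max_le_right hk)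

end ZeroDimScheme

end HilbertPolynomials

/-! ### The Chinese remainder theorem in large degrees -/

section ChineseRemainder

theorem mul_le_sup_inf_of_le_sup {R : Type*} [CommRing R] {A B J A' B' : Ideal R}
    (hA : A ≤ J ⊔ A') (hB : B ≤ J ⊔ B') : A * B ≤ J ⊔ (A' ⊓ B') := by
  rw [Ideal.mul_le]
  intro a ha b hb
  obtain ⟨u, hu, v, hv, rfl⟩ := Submodule.mem_sup.1 (hA ha)
  obtain ⟨w, hw, z, hz, rfl⟩ := Submodule.mem_sup.1 (hB hb)
  have : (u + v) * (w + z) = (u * (w + z) + v * w) + v * z := by ring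
  rw [this]
  refine Ideal.add_mem _ (Ideal.mem_sup_left ?_) (Ideal.mem_sup_right ⟨?_, ?_⟩)
  · exact J.add_mem (J.mul_mem_right _ hu) (J.mul_mem_left _ hw)
  · exact A'.mul_mem_right _ hv
  · exact B'.mul_mem_left _ hz

/-- If a power of `𝔪` is contained in each `J + Q k`, then one is contained in `J + ⨅ Q k`. -/
theorem pow_le_sup_inf {R ι : Type*} [CommRing R] {𝔪 J : Ideal R} {a : ℕ} (Q : ι → Ideal R)
    (s : Finset ι) (h : ∀ k ∈ s, 𝔪 ^ a ≤ J ⊔ Q k) : 𝔪 ^ (a * s.card) ≤ J ⊔ s.inf Q := by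
  classical
  induction s using Finset.induction_on with
  | empty => simp
  | insert k s hk ih =>
    rw [Finset.card_insert_of_notMem hk, mul_add, mul_one, pow_add, Finset.inf_insert]
    rw [inf_comm]
    exact mul_le_sup_inf_of_le_sup (ih fun i hi => h i (Finset.mem_insert_of_mem hi))
      (h k (Finset.mem_insert_self _ _))

variable {K : Type*} [Field K] {n : ℕ}

theorem finrank_quotComponent_iInf {ι : Type*} [Fintype ι]
    (Q : ι → Ideal (MvPolynomial (Fin (n + 1)) K))
    (hQ : ∀ j, ∀ f ∈ Q j, ∀ d, homogeneousComponent d f ∈ Q j) {a d : ℕ}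
    (ha : ∀ j k, j ≠ k → idealOfVars (Fin (n + 1)) K ^ a ≤ Q j ⊔ Q k)
    (hd : a * Fintype.card ι ≤ d) :
    Module.finrank K (quotComponent (⨅ j, Q j) d) =
      ∑ j, Module.finrank K (quotComponent (Q j) d) := by
  classical
  let T : homogeneousSubmodule (Fin (n + 1)) K d →ₗ[K] (∀ j, quotComponent (Q j) d) :=
    LinearMap.pi fun j => LinearMap.codRestrict _
      ((Ideal.Quotient.mkₐ K (Q j)).toLinearMap ∘ₗ (homogeneousSubmodule _ K d).subtype)
      (fun f => mk_mem_quotComponent (Q j) f.2)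
  have hTv : ∀ f j, (T f j : MvPolynomial (Fin (n + 1)) K ⧸ Q j) = Ideal.Quotient.mk (Q j) f.1 :=
    fun f j => rfl
  have hker : LinearMap.ker T = idealComponent (⨅ j, Q j) d := by
    ext f
    have h1 : f ∈ idealComponent (⨅ j, Q j) d ↔ f.1 ∈ ⨅ j, Q j := Iff.rfl
    rw [LinearMap.mem_ker, funext_iff, h1, Ideal.mem_iInf]
    refine forall_congr' fun j => ?_
    rw [← Ideal.Quotient.eq_zero_iff_mem, Subtype.ext_iff]
    rfl
  have hlift : ∀ j, ∀ v : quotComponent (Q j) d, Pi.single j v ∈ LinearMap.range T := by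
    intro j v
    obtain ⟨F, hF, hFv⟩ := mem_quotComponent.1 v.2
    have hFm : F ∈ Q j ⊔ (Finset.univ.erase j).inf Q := by
      refine pow_le_sup_inf Q _ (fun k hk => ha j k (Finset.ne_of_mem_erase hk).symm) ?_
      rw [mem_pow_idealOfVars_iff]
      intro e he
      have h1 := hF.degree_eq_sum_deg_support he
      have h2 : (Finset.univ.erase j).card ≤ Fintype.card ι := Finset.card_le_univ _
      refine ((Nat.mul_le_mul_left a h2).trans hd).trans h1.le
    -- As w agrees with F modulo Q_j and lies in every other Q_k, its component of degree d hits
    -- only the j-th factor.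
    obtain ⟨u, hu, w, hw, huw⟩ := Submodule.mem_sup.1 hFm
    refine ⟨⟨homogeneousComponent d w, homogeneousComponent_isHomogeneous _ _⟩, ?_⟩
    have hc : homogeneousComponent d u + homogeneousComponent d w = F := by
      rw [← map_add, huw, homogeneousComponent_eq_self hF]
    funext k
    apply Subtype.ext
    rw [hTv]
    by_cases hk : k = j
    · subst hk
      rw [Pi.single_eq_same, ← hFv, ← hc, map_add, Ideal.Quotient.eq_zero_iff_mem.2 (hQ k u hu d),
        zero_add]
    · rw [Pi.single_eq_of_ne hk]
      rw [Finset.inf_eq_iInf, Ideal.mem_iInf] at hw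
      have := Ideal.mem_iInf.1 (hw k) (Finset.mem_erase.2 ⟨hk, Finset.mem_univ _⟩)
      exact Ideal.Quotient.eq_zero_iff_mem.2 (hQ k w this d)
  have hrange : LinearMap.range T = ⊤ := by
    rw [eq_top_iff]
    intro v _
    rw [← Finset.univ_sum_single v]
    exact Submodule.sum_mem _ fun j _ => hlift j (v j)
  have h1 := LinearMap.finrank_range_add_finrank_ker (K := K)
    (V := homogeneousSubmodule (Fin (n + 1)) K d) (V₂ := ∀ j, quotComponent (Q j) d) T
  have hfree : ∀ j, Module.Free K (quotComponent (Q j) d) := fun j => inferInstance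
  rw [hrange, hker, finrank_top, Module.finrank_pi_fintype] at h1
  have h2 := finrank_quotComponent_add (⨅ j, Q j) d
  omega

end ChineseRemainder

/-! ### Ideals of rational points -/

section Points

variable {K : Type*} [Field K] {n : ℕ}

theorem mem_pointIdeal {q : Projectivization K (Fin (n + 1) → K)} {d : ℕ}
    {f : MvPolynomial (Fin (n + 1)) K} (hf : f.IsHomogeneous d) (h : eval q.rep f = 0) :
    f ∈ pointIdeal q :=
  Ideal.subset_span ⟨⟨d, hf⟩, h⟩

theorem idealOfVars_le_pointIdeal_sup {q r : Projectivization K (Fin (n + 1) → K)} (hqr : q ≠ r) :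
    idealOfVars (Fin (n + 1)) K ≤ pointIdeal q ⊔ pointIdeal r := by
  obtain ⟨a, b, hab⟩ : ∃ a b, r.rep a * q.rep b - r.rep b * q.rep a ≠ 0 := by
    by_contra! h
    apply hqr
    obtain ⟨b, hb⟩ := Function.ne_iff.1 q.rep_nonzero
    have hb : q.rep b ≠ 0 := hb
    rw [eq_comm, ← q.mk_rep, ← r.mk_rep, Projectivization.mk_eq_mk_iff']
    refine ⟨r.rep b / q.rep b, funext fun a => ?_⟩
    have := h a b
    rw [Pi.smul_apply, smul_eq_mul]
    field_simp
    linear_combination -this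
  rw [idealOfVars, Ideal.span_le]
  rintro _ ⟨i, rfl⟩
  set c := r.rep a * q.rep b - r.rep b * q.rep a with hc
  -- A linear form vanishing at r with value c ≠ 0 at q; hence c X_i - q_i L vanishes at q.
  let L : MvPolynomial (Fin (n + 1)) K := C (r.rep a) * X b - C (r.rep b) * X a
  have hL : L.IsHomogeneous 1 :=
    (isHomogeneous_C_mul_X _ _).sub (isHomogeneous_C_mul_X _ _)
  have hLr : L ∈ pointIdeal r := mem_pointIdeal hL (by simp [L]; ring)
  have hLq : C c * X i - C (q.rep i) * L ∈ pointIdeal q := by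
    refine mem_pointIdeal (d := 1) ((isHomogeneous_C_mul_X _ _).sub (hL.C_mul _)) ?_
    simp only [L, hc, map_sub, map_mul, eval_C, eval_X]
    ring
  have hX : X i = C c⁻¹ * (C c * X i - C (q.rep i) * L) + C c⁻¹ * C (q.rep i) * L := by
    have : (C c⁻¹ * C c : MvPolynomial (Fin (n + 1)) K) = 1 := by
      rw [← C_mul, inv_mul_cancel₀ hab, C_1]
    linear_combination (- X i) * this
  rw [hX]
  exact Ideal.add_mem _ (Ideal.mul_mem_left _ _ (Ideal.mem_sup_left hLq))
    (Ideal.mul_mem_left _ _ (Ideal.mem_sup_right hLr))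

theorem idealOfVars_pow_le_pointIdeal_pow_sup {q r : Projectivization K (Fin (n + 1) → K)}
    (hqr : q ≠ r) (a b : ℕ) :
    idealOfVars (Fin (n + 1)) K ^ (a + b) ≤ pointIdeal q ^ a ⊔ pointIdeal r ^ b :=
  (Ideal.pow_right_mono (idealOfVars_le_pointIdeal_sup hqr) _).trans
    Ideal.sup_pow_add_le_pow_sup_pow

theorem homogeneousComponent_mem_pointIdeal_pow (q : Projectivization K (Fin (n + 1) → K)) (m : ℕ)
    {f : MvPolynomial (Fin (n + 1)) K} (hf : f ∈ pointIdeal q ^ m) (d : ℕ) :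
    homogeneousComponent d f ∈ pointIdeal q ^ m := by
  let := gradedAlgebra (σ := Fin (n + 1)) (R := K)
  have h1 : (pointIdeal q).IsHomogeneous (homogeneousSubmodule (Fin (n + 1)) K) :=
    Ideal.homogeneous_span _ _ fun f hf => hf.1
  have h2 : ∀ m, (pointIdeal q ^ m).IsHomogeneous (homogeneousSubmodule (Fin (n + 1)) K) := by
    intro m
    induction m with
    | zero =>
      rw [pow_zero, Ideal.one_eq_top]
      exact Ideal.IsHomogeneous.top _
    | succ m ih =>
      rw [pow_succ]
      exact Ideal.IsHomogeneous.mul ih h1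
  exact homogeneousComponent_mem_of_mem (h2 m) hf d

theorem homogeneousComponent_mem_diffPower_two {I : Ideal (MvPolynomial (Fin (n + 1)) K)}
    (hI : ∀ f ∈ I, ∀ d, homogeneousComponent d f ∈ I) {f : MvPolynomial (Fin (n + 1)) K}
    (hf : f ∈ diffPower K I 2) (d : ℕ) : homogeneousComponent d f ∈ diffPower K I 2 := by
  rw [mem_diffPower_two_iff] at hf ⊢
  refine ⟨hI f hf.1 d, fun i => ?_⟩
  cases d with
  | zero => simp
  | succ d =>
    rw [← homogeneousComponent_pderiv]
    exact hI _ (hf.2 i) d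

theorem sq_le_diffPower_two (I : Ideal (MvPolynomial (Fin (n + 1)) K)) :
    I ^ 2 ≤ diffPower K I 2 := by
  rw [pow_two, Ideal.mul_le]
  intro a ha b hb
  rw [mem_diffPower_two_iff]
  refine ⟨I.mul_mem_left _ hb, fun i => ?_⟩
  rw [pderiv_mul]
  exact I.add_mem (I.mul_mem_left _ hb) (I.mul_mem_right _ ha)

theorem diffPower_iInf {R ι : Type*} [CommRing R] [Algebra K R] (J : ι → Ideal R) (m : ℕ) :
    diffPower K (⨅ j, J j) m = ⨅ j, diffPower K (J j) m := by
  ext f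
  rw [Ideal.mem_iInf]
  constructor
  · intro h j δ hδ
    exact Ideal.mem_iInf.1 (h δ hδ) j
  · intro h δ hδ
    exact Ideal.mem_iInf.2 fun j => h j δ hδ

end Points

/-! ### Moving a rational point to a coordinate point -/

section CoordinateChange

variable {K : Type*} [Field K]

theorem IsDiffOp.conj {R S : Type*} [CommRing R] [CommRing S] [Algebra K R] [Algebra K S]
    (e : R ≃ₐ[K] S) (m : ℕ) {δ : R →ₗ[K] R} (h : IsDiffOp K R m δ) :
    IsDiffOp K S m (e.toLinearMap ∘ₗ δ ∘ₗ e.symm.toLinearMap) := by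
  induction m generalizing δ with
  | zero =>
    intro f g
    have := h (e.symm f) (e.symm g)
    simp [this]
  | succ m ih =>
    intro f
    convert! ih (h (e.symm f)) using 1
    ext g
    simp

theorem map_diffPower_le {R S : Type*} [CommRing R] [CommRing S] [Algebra K R] [Algebra K S]
    (e : R ≃ₐ[K] S) (J : Ideal R) (m : ℕ) :
    (diffPower K J m).map e ≤ diffPower K (J.map e) m := by
  rw [Ideal.map_le_iff_le_comap]
  intro f hf δ hδ
  have h1 := hf _ (hδ.conj e.symm)
  have h2 := Ideal.mem_map_of_mem e h1
  simpa using h2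

theorem map_algEquiv_map_symm {R S : Type*} [CommRing R] [CommRing S] [Algebra K R] [Algebra K S]
    (e : R ≃ₐ[K] S) (I : Ideal R) : (I.map e).map e.symm = I := by
  ext x
  simp only [Ideal.mem_map_of_equiv]
  constructor
  · rintro ⟨_, ⟨y, hy, rfl⟩, rfl⟩
    simpa using hy
  · exact fun hx => ⟨e x, ⟨x, hx, rfl⟩, by simp⟩

/-- Conjugation by an isomorphism preserves the order of differential operators; applying the easy
inclusion to the inverse gives equality. -/
theorem diffPower_map {R S : Type*} [CommRing R] [CommRing S] [Algebra K R] [Algebra K S]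
    (e : R ≃ₐ[K] S) (J : Ideal R) (m : ℕ) :
    diffPower K (J.map e) m = (diffPower K J m).map e := by
  refine le_antisymm ?_ (map_diffPower_le e J m)
  have h := Ideal.map_mono (f := e) (map_diffPower_le e.symm (J.map e) m)
  have hid := map_algEquiv_map_symm e.symm (diffPower K (J.map e) m)
  rw [AlgEquiv.symm_symm] at hid
  rwa [hid, map_algEquiv_map_symm] at h

variable {n : ℕ}

theorem finrank_quotComponent_map
    (e : MvPolynomial (Fin (n + 1)) K ≃ₐ[K] MvPolynomial (Fin (n + 1)) K)
    (h1 : ∀ f d, f.IsHomogeneous d → (e f).IsHomogeneous d)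
    (h2 : ∀ f d, f.IsHomogeneous d → (e.symm f).IsHomogeneous d)
    (J : Ideal (MvPolynomial (Fin (n + 1)) K)) (d : ℕ) :
    Module.finrank K (quotComponent (J.map e) d) = Module.finrank K (quotComponent J d) := by
  let T : homogeneousSubmodule (Fin (n + 1)) K d ≃ₗ[K] homogeneousSubmodule (Fin (n + 1)) K d :=
    LinearEquiv.ofSubmodules e.toLinearEquiv _ _ (by
      ext f
      constructor
      · rintro ⟨g, hg, rfl⟩
        exact h1 g d hg
      · intro hf
        exact ⟨e.symm f, h2 f d hf, by simp⟩)
  have hT : ∀ f, (T f : MvPolynomial (Fin (n + 1)) K) = e f := fun f => rfl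
  have hmap : (idealComponent J d).map T.toLinearMap = idealComponent (J.map e) d := by
    ext f
    constructor
    · rintro ⟨g, hg, rfl⟩
      exact Ideal.mem_map_of_mem e hg
    · intro hf
      obtain ⟨g, rfl⟩ := T.surjective f
      refine ⟨g, ?_, rfl⟩
      obtain ⟨g', hg', hgg⟩ := (Ideal.mem_map_of_equiv e _).1 hf
      have : g' = g := e.injective (hgg.trans (hT g).symm)
      change (g : MvPolynomial (Fin (n + 1)) K) ∈ J
      rwa [← this]
  have h3 := finrank_quotComponent_add J d
  have h4 := finrank_quotComponent_add (J.map e) d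
  rw [← hmap, LinearEquiv.finrank_map_eq] at h4
  omega

/-- The substitution `X_i ↦ X_i + c_i X_{i₀}`. -/
def shearHom (i₀ : Fin (n + 1)) (c : Fin (n + 1) → K) :
    MvPolynomial (Fin (n + 1)) K →ₐ[K] MvPolynomial (Fin (n + 1)) K :=
  aeval fun i => X i + C (c i) * X i₀

theorem shearHom_comp_neg {i₀ : Fin (n + 1)} {c : Fin (n + 1) → K} (hc : c i₀ = 0) :
    (shearHom i₀ c).comp (shearHom i₀ (-c)) = AlgHom.id K _ := by
  ext i : 1
  simp [shearHom, hc]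

/-- The linear change of coordinates `X_i ↦ X_i + c_i X_{i₀}`, where `c_{i₀} = 0`. -/
def shear (i₀ : Fin (n + 1)) (c : Fin (n + 1) → K) (hc : c i₀ = 0) :
    MvPolynomial (Fin (n + 1)) K ≃ₐ[K] MvPolynomial (Fin (n + 1)) K :=
  AlgEquiv.ofAlgHom (shearHom i₀ c) (shearHom i₀ (-c)) (shearHom_comp_neg hc) (by
    have := shearHom_comp_neg (i₀ := i₀) (c := -c) (by simp [hc])
    rwa [neg_neg] at this)

theorem isHomogeneous_shearHom (i₀ : Fin (n + 1)) (c : Fin (n + 1) → K)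
    {f : MvPolynomial (Fin (n + 1)) K} {d : ℕ} (hf : f.IsHomogeneous d) :
    (shearHom i₀ c f).IsHomogeneous d := by
  have := hf.aeval (fun i => X i + C (c i) * X i₀)
    (fun i => (isHomogeneous_X K i).add (isHomogeneous_C_mul_X (c i) i₀))
  rwa [one_mul] at this

/-- The ideal generated by all variables but one, the vanishing ideal of a coordinate point. -/
def coordPointIdeal (K : Type*) [Field K] {n : ℕ} (i₀ : Fin (n + 1)) :
    Ideal (MvPolynomial (Fin (n + 1)) K) :=
  Ideal.span (X '' {i | i ≠ i₀})

theorem mem_coordPointIdeal_of_eval_eq_zero {i₀ : Fin (n + 1)} {t : K} (ht : t ≠ 0) {d : ℕ}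
    {f : MvPolynomial (Fin (n + 1)) K} (hf : f.IsHomogeneous d)
    (h : eval (Pi.single i₀ t) f = 0) : f ∈ coordPointIdeal K i₀ := by
  rw [coordPointIdeal, mem_ideal_span_X_image]
  intro e he
  by_contra! hcon
  -- The only monomial of degree d outside the ideal is X_{i₀}^d, which is also the only one that
  -- can survive evaluation at the coordinate point.
  have hsingle : ∀ e' ∈ f.support, (∀ i, i ≠ i₀ → e' i = 0) → e' = Finsupp.single i₀ d := by
    intro e' he' h'
    have h1 : e' = Finsupp.single i₀ (e' i₀) := by
      ext i
      by_cases hi : i = i₀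
      · subst hi; simp
      · rw [h' i hi, Finsupp.single_eq_of_ne hi]
    have h2 : e'.degree = d := (hf.degree_eq_sum_deg_support he').symm
    rw [h1, Finsupp.degree_single] at h2
    rw [← h2]
    exact h1
  have he1 := hsingle e he (fun i hi => hcon i hi)
  rw [eval_eq, Finset.sum_eq_single e] at h
  · refine (mul_ne_zero (mem_support_iff.1 he) ?_) h
    refine Finset.prod_ne_zero_iff.2 fun i hi => ?_
    by_cases hii : i = i₀
    · subst hii
      rw [Pi.single_eq_same]
      exact pow_ne_zero _ ht
    · exact absurd (hcon i hii) (Finsupp.mem_support_iff.1 hi)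
  · intro e' he' hne
    obtain ⟨i, hi, hie⟩ : ∃ i, i ≠ i₀ ∧ e' i ≠ 0 := by
      by_contra! h'
      exact hne ((hsingle e' he' h').trans he1.symm)
    refine mul_eq_zero_of_right _ (Finset.prod_eq_zero (Finsupp.mem_support_iff.2 hie) ?_)
    rw [Pi.single_eq_of_ne hi, zero_pow hie]
  · exact fun h' => absurd he h'

/-- Up to a linear change of coordinates, every rational point is a coordinate point. -/
theorem exists_shear_map_eq_pointIdeal (q : Projectivization K (Fin (n + 1) → K)) :
    ∃ (i₀ : Fin (n + 1)) (c : Fin (n + 1) → K) (hc : c i₀ = 0),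
      (coordPointIdeal K i₀).map (shear i₀ c hc) = pointIdeal q := by
  obtain ⟨i₀, hi₀⟩ := Function.ne_iff.1 q.rep_nonzero
  have hi₀ : q.rep i₀ ≠ 0 := hi₀
  let b : Fin (n + 1) → K := fun i => if i = i₀ then 0 else q.rep i / q.rep i₀
  have hb : ∀ i, i ≠ i₀ → b i = q.rep i / q.rep i₀ := fun i hi => if_neg hi
  have hb0 : b i₀ = 0 := if_pos rfl
  have hc : (-b) i₀ = 0 := by simp [hb0]
  refine ⟨i₀, -b, hc, le_antisymm ?_ ?_⟩
  · rw [coordPointIdeal, Ideal.map_span, Ideal.span_le]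
    rintro _ ⟨_, ⟨i, hi, rfl⟩, rfl⟩
    refine mem_pointIdeal (isHomogeneous_shearHom i₀ (-b) (isHomogeneous_X K i)) ?_
    have hi : i ≠ i₀ := hi
    change eval q.rep (shearHom i₀ (-b) (X i)) = 0
    simp [shearHom, hb i hi]
    field_simp
    ring
  · rw [pointIdeal, Ideal.span_le]
    rintro f ⟨⟨d, hf⟩, hfq⟩
    -- The inverse shear is compatible with evaluation: its value at the point with single nonzero
    -- entry q_{i₀} is f(q) = 0.
    have h1 : shearHom i₀ b f ∈ coordPointIdeal K i₀ := by
      refine mem_coordPointIdeal_of_eval_eq_zero hi₀ (isHomogeneous_shearHom i₀ b hf) ?_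
      rw [← hfq, shearHom, ← coe_aeval_eq_eval, ← coe_aeval_eq_eval]
      change ((aeval _).comp (aeval _)) f = aeval _ f
      congr 1
      ext i
      by_cases hi : i = i₀
      · subst hi; simp [hb0]
      · simp [hb i hi, hi, hi₀]
    have h2 := Ideal.mem_map_of_mem (shear i₀ (-b) hc) h1
    have h3 : shear i₀ (-b) hc (shearHom i₀ b f) = f := by
      have := shearHom_comp_neg (i₀ := i₀) (c := -b) hc
      rw [neg_neg] at this
      exact congrArg (fun φ => φ f) this
    rwa [h3] at h2

theorem exists_finrank_quotComponent_pointIdeal_eq (q : Projectivization K (Fin (n + 1) → K)) :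
    ∃ i₀ : Fin (n + 1), ∀ m d,
      Module.finrank K (quotComponent (pointIdeal q ^ m) d) =
        Module.finrank K (quotComponent (coordPointIdeal K i₀ ^ m) d) ∧
      Module.finrank K (quotComponent (diffPower K (pointIdeal q ^ m) 2) d) =
        Module.finrank K (quotComponent (diffPower K (coordPointIdeal K i₀ ^ m) 2) d) := by
  obtain ⟨i₀, c, hc, h⟩ := exists_shear_map_eq_pointIdeal q
  refine ⟨i₀, fun m d => ?_⟩
  have hm : pointIdeal q ^ m = (coordPointIdeal K i₀ ^ m).map (shear i₀ c hc) := by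
    rw [← h, Ideal.map_pow]
  have h1 : ∀ f d, f.IsHomogeneous d → (shear i₀ c hc f).IsHomogeneous d :=
    fun f d hf => isHomogeneous_shearHom i₀ c hf
  have h2 : ∀ f d, f.IsHomogeneous d → ((shear i₀ c hc).symm f).IsHomogeneous d :=
    fun f d hf => isHomogeneous_shearHom i₀ (-c) hf
  rw [hm, diffPower_map]
  exact ⟨finrank_quotComponent_map _ h1 h2 _ d, finrank_quotComponent_map _ h1 h2 _ d⟩

end CoordinateChange

/-! ### Counting monomials at a coordinate point -/

section MonomialCount

variable {K : Type*} [Field K] {n : ℕ}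

/-- The exponents of total degree `d`. -/
def degExponents (n d : ℕ) : Finset (Fin (n + 1) →₀ ℕ) := Finset.univ.finsuppAntidiag d

theorem mem_degExponents {d : ℕ} {e : Fin (n + 1) →₀ ℕ} :
    e ∈ degExponents n d ↔ e.degree = d := by
  simp [degExponents, Finset.mem_finsuppAntidiag, Finsupp.degree_eq_sum]

theorem card_degExponents (n d : ℕ) : (degExponents n d).card = (n + d).choose d := by
  rw [degExponents, Finset.card_finsuppAntidiag_nat_eq_choose, Finset.card_univ, Fintype.card_fin]
  congr 1
  omega

/-- The Hilbert function of a monomial ideal counts the monomials outside of it. -/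
theorem finrank_quotComponent_of_monomial {J : Ideal (MvPolynomial (Fin (n + 1)) K)}
    {P : (Fin (n + 1) →₀ ℕ) → Prop} [DecidablePred P]
    (hJ : ∀ f, f ∈ J ↔ ∀ e ∈ f.support, P e) (d : ℕ) :
    Module.finrank K (quotComponent J d) = ((degExponents n d).filter fun e => ¬ P e).card := by
  set s := (degExponents n d).filter fun e => ¬ P e with hs
  let T : homogeneousSubmodule (Fin (n + 1)) K d →ₗ[K] (s → K) :=
    LinearMap.pi fun e => lcoeff K e.1 ∘ₗ (homogeneousSubmodule _ K d).subtype
  have hTv : ∀ f e, T f e = coeff e.1 f.1 := fun f e => rfl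
  have hker : LinearMap.ker T = idealComponent J d := by
    ext f
    have h1 : f ∈ idealComponent J d ↔ f.1 ∈ J := Iff.rfl
    rw [LinearMap.mem_ker, h1, hJ, funext_iff]
    constructor
    · intro h e he
      by_contra hP
      have hes : e ∈ s := Finset.mem_filter.2
        ⟨mem_degExponents.2 (f.2.degree_eq_sum_deg_support he).symm, hP⟩
      exact mem_support_iff.1 he (h ⟨e, hes⟩)
    · intro h e
      rw [hTv, Pi.zero_apply]
      by_contra hne
      exact (Finset.mem_filter.1 e.2).2 (h e.1 (mem_support_iff.2 hne))
  have hrange : LinearMap.range T = ⊤ := by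
    rw [LinearMap.range_eq_top]
    intro v
    refine ⟨⟨∑ e : s, monomial e.1 (v e), Submodule.sum_mem _ fun e _ =>
      isHomogeneous_monomial _ (mem_degExponents.1 (Finset.mem_filter.1 e.2).1)⟩, ?_⟩
    funext e
    rw [hTv]
    simp [coeff_sum, coeff_monomial]
  have h1 := LinearMap.finrank_range_add_finrank_ker (K := K)
    (V := homogeneousSubmodule (Fin (n + 1)) K d) (V₂ := s → K) T
  rw [hrange, hker, finrank_top, Module.finrank_fintype_fun_eq_card, Fintype.card_coe] at h1
  have h2 := finrank_quotComponent_add J d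
  omega

/-- The degree in all variables but `X i₀`. -/
def partialDegree (i₀ : Fin (n + 1)) (e : Fin (n + 1) →₀ ℕ) : ℕ := ∑ k, e (i₀.succAbove k)

theorem degree_eq_add_partialDegree (i₀ : Fin (n + 1)) (e : Fin (n + 1) →₀ ℕ) :
    e.degree = e i₀ + partialDegree i₀ e := by
  rw [Finsupp.degree_eq_sum, Fin.sum_univ_succAbove _ i₀, partialDegree]

theorem partialDegree_add (i₀ : Fin (n + 1)) (e e' : Fin (n + 1) →₀ ℕ) :
    partialDegree i₀ (e + e') = partialDegree i₀ e + partialDegree i₀ e' := by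
  simp [partialDegree, Finset.sum_add_distrib]

theorem partialDegree_single_self (i₀ : Fin (n + 1)) (a : ℕ) :
    partialDegree i₀ (Finsupp.single i₀ a) = 0 := by
  simp [partialDegree]

theorem partialDegree_single_succAbove (i₀ : Fin (n + 1)) (k : Fin n) (a : ℕ) :
    partialDegree i₀ (Finsupp.single (i₀.succAbove k) a) = a := by
  simp [partialDegree, Finsupp.single_apply]

theorem mem_coordPointIdeal_pow_iff (i₀ : Fin (n + 1)) (m : ℕ)
    (f : MvPolynomial (Fin (n + 1)) K) :
    f ∈ coordPointIdeal K i₀ ^ m ↔ ∀ e ∈ f.support, m ≤ partialDegree i₀ e := by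
  classical
  constructor
  · induction m generalizing f with
    | zero => simp
    | succ m ih =>
      intro hf
      rw [pow_succ] at hf
      refine Submodule.mul_induction_on hf (fun g hg h hh => ?_) (fun g h hg hh => ?_)
      · intro e he
        obtain ⟨e₁, he₁, e₂, he₂, rfl⟩ := Finset.mem_add.1 (support_mul g h he)
        rw [partialDegree_add]
        refine Nat.add_le_add (ih g hg e₁ he₁) ?_
        obtain ⟨i, hi, hie⟩ := mem_ideal_span_X_image.1 hh e₂ he₂
        obtain ⟨k, rfl⟩ := Fin.exists_succAbove_eq hi
        have := Finset.single_le_sum (f := fun k => e₂ (i₀.succAbove k))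
          (fun _ _ => Nat.zero_le _) (Finset.mem_univ k)
        rw [partialDegree]
        omega
      · intro e he
        rcases Finset.mem_union.1 (support_add he) with h | h
        · exact hg e h
        · exact hh e h
  · intro h
    rw [f.as_sum]
    refine Ideal.sum_mem _ fun e he => ?_
    refine Ideal.pow_le_pow_right (h e he) ?_
    rw [monomial_eq, Finsupp.prod_fintype _ _ (by simp), Fin.prod_univ_succAbove _ i₀]
    refine Ideal.mul_mem_left _ _ (Ideal.mul_mem_left _ _ ?_)
    rw [partialDegree, ← Finset.prod_pow_eq_pow_sum]
    refine Ideal.prod_mem_prod fun k _ => Ideal.pow_mem_pow (Ideal.subset_span ?_) _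
    exact ⟨_, Fin.succAbove_ne i₀ k, rfl⟩

/-- A derivative in a local variable lowers `partialDegree` by one and multiplies by the exponent,
whereas ∂/∂X_{i₀} does not change it. So the derivatives constrain only the monomials of partial
degree exactly m, whose local exponents must all vanish in K. -/
theorem mem_diffPower_coordPointIdeal_pow_iff (i₀ : Fin (n + 1)) (m : ℕ)
    (f : MvPolynomial (Fin (n + 1)) K) :
    f ∈ diffPower K (coordPointIdeal K i₀ ^ m) 2 ↔ ∀ e ∈ f.support, m ≤ partialDegree i₀ e ∧
      (partialDegree i₀ e = m → ∀ k, (e (i₀.succAbove k) : K) = 0) := by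
  rw [mem_diffPower_two_iff]
  simp only [mem_coordPointIdeal_pow_iff]
  constructor
  · rintro ⟨h1, h2⟩ e he
    refine ⟨h1 e he, fun hem k => ?_⟩
    by_contra hne
    have hpos : e (i₀.succAbove k) ≠ 0 := by
      rintro h
      rw [h, Nat.cast_zero] at hne
      exact hne rfl
    have hle : Finsupp.single (i₀.succAbove k) 1 ≤ e := by
      rw [Finsupp.single_le_iff]
      omega
    have hsum := tsub_add_cancel_of_le hle
    have hdeg := congrArg (partialDegree i₀) hsum
    rw [partialDegree_add, partialDegree_single_succAbove, hem] at hdeg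
    have := h2 (i₀.succAbove k) (e - Finsupp.single (i₀.succAbove k) 1) (by
      rw [mem_support_iff, coeff_pderiv, hsum]
      refine mul_ne_zero (mem_support_iff.1 he) ?_
      rw [Finsupp.tsub_apply, Finsupp.single_eq_same]
      rwa [← Nat.cast_add_one, Nat.sub_add_cancel (by omega)])
    omega
  · intro h
    refine ⟨fun e he => (h e he).1, fun i e he => ?_⟩
    rw [mem_support_iff, coeff_pderiv] at he
    have h1 := left_ne_zero_of_mul he
    have h2 := right_ne_zero_of_mul he
    have h3 := h _ (mem_support_iff.2 h1)
    rw [partialDegree_add] at h3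
    by_cases hi : i = i₀
    · subst hi
      rw [partialDegree_single_self, add_zero] at h3
      exact h3.1
    · obtain ⟨k, rfl⟩ := Fin.exists_succAbove_eq hi
      rw [partialDegree_single_succAbove] at h3
      by_contra hlt
      refine h2 ?_
      have := h3.2 (by omega) k
      simpa using this

/-- Such monomials are divisible by X_{i₀}^{d+1-m}, and dividing by this power leaves an arbitrary
monomial of degree m - 1. -/
theorem card_filter_partialDegree_lt (i₀ : Fin (n + 1)) {m d : ℕ} (hm : 1 ≤ m) (hmd : m ≤ d + 1) :
    ((degExponents n d).filter fun e => partialDegree i₀ e < m).card = (m + n - 1).choose n := by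
  have h1 : (m + n - 1).choose n = (degExponents n (m - 1)).card := by
    rw [card_degExponents, show m + n - 1 = n + (m - 1) by omega, Nat.choose_symm_add]
  rw [h1]
  symm
  refine Finset.card_bij (fun e _ => e + Finsupp.single i₀ (d + 1 - m)) ?_ ?_ ?_
  · intro e he
    rw [mem_degExponents] at he
    rw [Finset.mem_filter, mem_degExponents, map_add, Finsupp.degree_single, he, partialDegree_add,
      partialDegree_single_self]
    rw [degree_eq_add_partialDegree i₀] at he
    omega
  · intro e _ e' _ h
    exact add_right_cancel h
  · intro e he
    rw [Finset.mem_filter, mem_degExponents] at he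
    have h2 := degree_eq_add_partialDegree i₀ e
    have hle : Finsupp.single i₀ (d + 1 - m) ≤ e := by
      rw [Finsupp.single_le_iff]
      omega
    have hsum := tsub_add_cancel_of_le hle
    refine ⟨e - Finsupp.single i₀ (d + 1 - m), ?_, hsum⟩
    have := congrArg Finsupp.degree hsum
    rw [map_add, Finsupp.degree_single] at this
    rw [mem_degExponents]
    omega

-- Division of the local exponents by p is a bijection, since the exponent of X_{i₀} is forced to be
-- d - m. For p = 0 the condition p ∣ m fails because m ≥ 1.
open Classical in
theorem card_filter_partialDegree_eq (i₀ : Fin (n + 1)) (p : ℕ) {m d : ℕ} (hm : 1 ≤ m)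
    (hmd : m ≤ d) :
    ((degExponents n d).filter fun e =>
        partialDegree i₀ e = m ∧ ∀ k, p ∣ e (i₀.succAbove k)).card =
      if p ∣ m then {α : Fin n → ℕ | ∑ i, α i = m / p}.ncard else 0 := by
  split_ifs with hp
  · have hp0 : 0 < p := Nat.pos_of_dvd_of_pos hp hm
    rw [← Set.ncard_coe_finset]
    refine Set.ncard_congr (fun e _ k => e (i₀.succAbove k) / p) ?_ ?_ ?_
    · intro e he
      obtain ⟨-, he1, he2⟩ := Finset.mem_filter.1 (Finset.mem_coe.1 he)
      change ∑ k, e (i₀.succAbove k) / p = m / p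
      rw [← he1, partialDegree, Nat.sum_div fun k _ => he2 k]
    · intro e e' he he' h
      obtain ⟨hd, he1, he2⟩ := Finset.mem_filter.1 (Finset.mem_coe.1 he)
      obtain ⟨hd', he1', he2'⟩ := Finset.mem_filter.1 (Finset.mem_coe.1 he')
      rw [mem_degExponents, degree_eq_add_partialDegree i₀] at hd hd'
      ext i
      by_cases hi : i = i₀
      · subst hi
        omega
      · obtain ⟨k, rfl⟩ := Fin.exists_succAbove_eq hi
        have := congrFun h k
        rw [← Nat.div_mul_cancel (he2 k), ← Nat.div_mul_cancel (he2' k)]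
        exact congrArg (· * p) this
    · intro α hα
      have hα : ∑ i, α i = m / p := hα
      let e : Fin (n + 1) →₀ ℕ :=
        Finsupp.equivFunOnFinite.symm (i₀.insertNth (d - m) fun k => α k * p)
      have hek : ∀ k, e (i₀.succAbove k) = α k * p := fun k => by simp [e]
      have he0 : e i₀ = d - m := by simp [e]
      have hpd : partialDegree i₀ e = m := by
        rw [partialDegree, Finset.sum_congr rfl fun k _ => hek k, ← Finset.sum_mul, hα,
          Nat.div_mul_cancel hp]
      refine ⟨e, Finset.mem_coe.2 (Finset.mem_filter.2 ⟨?_, hpd, fun k => ?_⟩), ?_⟩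
      · rw [mem_degExponents, degree_eq_add_partialDegree i₀, he0, hpd]
        omega
      · rw [hek]
        exact dvd_mul_left _ _
      · funext k
        rw [hek, Nat.mul_div_cancel _ hp0]
  · rw [Finset.card_eq_zero, Finset.filter_eq_empty_iff]
    rintro e - ⟨h1, h2⟩
    exact hp (h1 ▸ Finset.dvd_sum fun k _ => h2 k)

theorem finrank_quotComponent_coordPointIdeal_pow (i₀ : Fin (n + 1)) {m d : ℕ} (hm : 1 ≤ m)
    (hmd : m ≤ d) :
    Module.finrank K (quotComponent (coordPointIdeal K i₀ ^ m) d) = (m + n - 1).choose n := by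
  classical
  rw [finrank_quotComponent_of_monomial (mem_coordPointIdeal_pow_iff i₀ m),
    ← card_filter_partialDegree_lt i₀ hm (show m ≤ d + 1 by omega)]
  congr 1
  ext e
  simp

-- Monomials outside the differential power have partial degree less than m, or equal to m with some
-- local exponent nonzero in K. Adding those of partial degree m with all local exponents divisible
-- by p gives exactly the partial degrees below m + 1.
open Classical in
theorem finrank_quotComponent_diffPower_coordPointIdeal_pow (p : ℕ) [CharP K p] (i₀ : Fin (n + 1))
    {m d : ℕ} (hm : 1 ≤ m) (hmd : m ≤ d) :
    Module.finrank K (quotComponent (diffPower K (coordPointIdeal K i₀ ^ m) 2) d) +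
      (if p ∣ m then {α : Fin n → ℕ | ∑ i, α i = m / p}.ncard else 0) = (m + n).choose n := by
  rw [finrank_quotComponent_of_monomial (mem_diffPower_coordPointIdeal_pow_iff i₀ m),
    ← card_filter_partialDegree_eq i₀ p hm hmd]
  have h1 := card_filter_partialDegree_lt i₀ (n := n) (m := m + 1) (d := d) (by omega) (by omega)
  rw [show m + 1 + n - 1 = m + n by omega] at h1
  rw [← h1, ← Finset.card_union_of_disjoint]
  · congr 1
    ext e
    simp only [CharP.cast_eq_zero_iff K p, Finset.mem_union, Finset.mem_filter, not_and_or,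
      not_le, Classical.not_imp]
    rw [← and_or_left]
    refine and_congr_right fun _ => ?_
    by_cases h : ∀ k, p ∣ e (i₀.succAbove k)
    · simp only [h, implies_true, not_true, and_true, and_false, or_false]
      omega
    · simp only [h, not_false_iff, and_true, and_false, or_false]
      omega
  · rw [Finset.disjoint_filter]
    rintro e - h ⟨h2, h3⟩
    refine h ⟨h2.ge, fun _ k => ?_⟩
    rw [CharP.cast_eq_zero_iff K p]
    exact h3 k

end MonomialCount

/-! ### Fat point schemes -/

section FatPoints

theorem choose_fat_point_ge_two {n m : ℕ} (hn : 1 ≤ n) (hm : 2 ≤ m) :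
    2 ≤ ((n : ℚ) + 2) * ((m + n - 1).choose n : ℚ) - ((m + n).choose n : ℚ) := by
  obtain ⟨k, rfl⟩ : ∃ k, m = k + 1 := ⟨m - 1, by omega⟩
  have h1 : (k + 1 + n).choose n * (k + 1) = (k + n).choose n * (k + n + 1) := by
    have := Nat.add_one_mul_choose_eq (k + n) k
    rw [Nat.choose_symm_add, show k + n + 1 = (k + 1) + n by ring, Nat.choose_symm_add] at this
    rw [show k + n + 1 = k + 1 + n by ring]
    linarith
  have h2 : 2 ≤ (k + n).choose n := by
    have := Nat.choose_le_choose n (show n + 1 ≤ k + n by omega)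
    rw [Nat.choose_succ_self_right] at this
    omega
  rw [show k + 1 + n - 1 = k + n by omega]
  have hk : (1 : ℚ) ≤ k := by exact_mod_cast (by omega : 1 ≤ k)
  have hn' : (1 : ℚ) ≤ n := by exact_mod_cast hn
  have h1' : ((k + 1 + n).choose n : ℚ) * (k + 1) = (k + n).choose n * (k + n + 1) := by
    exact_mod_cast h1
  have h2' : (2 : ℚ) ≤ (k + n).choose n := by exact_mod_cast h2
  set a : ℚ := ((k + n).choose n : ℚ)
  set b : ℚ := ((k + 1 + n).choose n : ℚ)
  -- Multiplying by k + 1 = m clears the denominator in b = a (k + n + 1) / (k + 1).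
  have h3 : ((n + 2) * a - b) * (k + 1) = a * ((n : ℚ) * k + k + 1) := by
    linear_combination -h1'
  have h4 : 2 * ((k : ℚ) + 1) ≤ a * ((n : ℚ) * k + k + 1) := by
    refine mul_le_mul h2' ?_ (by positivity) (by positivity)
    nlinarith
  rw [← h3] at h4
  exact le_of_mul_le_mul_right h4 (by positivity)

namespace ZeroDimScheme

variable {K : Type*} [Field K] {n : ℕ} {X : ZeroDimScheme K n} {s : ℕ}
  {q : Fin s → Projectivization K (Fin (n + 1) → K)} {m : Fin s → ℕ}

theorem degree_eq_of_isFatPointScheme (h : IsFatPointScheme X q m) :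
    X.degree = ∑ j, ((m j + n - 1).choose n : ℚ) := by
  have hle : ∀ j, m j ≤ ∑ k, m k := fun j =>
    Finset.single_le_sum (fun _ _ => Nat.zero_le _) (Finset.mem_univ j)
  set M := ∑ k, m k
  have key : ∀ d ≥ M + (M + M) * s, Module.finrank K (quotComponent X.ideal d) =
      ∑ j, (m j + n - 1).choose n := by
    intro d hd
    rw [h.ideal_eq, finrank_quotComponent_iInf (a := M + M)]
    · refine Finset.sum_congr rfl fun j _ => ?_
      obtain ⟨i₀, hi₀⟩ := exists_finrank_quotComponent_pointIdeal_eq (q j)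
      rw [(hi₀ (m j) d).1]
      exact finrank_quotComponent_coordPointIdeal_pow i₀ (h.pos j) (by have := hle j; omega)
    · exact fun j f hf d => homogeneousComponent_mem_pointIdeal_pow _ _ hf d
    · intro j k hjk
      refine (Ideal.pow_le_pow_right (Nat.add_le_add (hle j) (hle k))).trans ?_
      exact idealOfVars_pow_le_pointIdeal_pow_sup (fun h' => hjk (h.distinct h')) _ _
    · rw [Fintype.card_fin]
      omega
  rw [X.degree_eq_of_eventually key, Nat.cast_sum]

open Classical in
theorem degree_diffFattening_of_isFatPointScheme (p : ℕ) [CharP K p]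
    (h : IsFatPointScheme X q m) :
    X.diffFattening.degree + ∑ j with p ∣ m j, ({α : Fin n → ℕ | ∑ i, α i = m j / p}.ncard : ℚ) =
      ∑ j, ((m j + n).choose n : ℚ) := by
  have hle : ∀ j, m j ≤ ∑ k, m k := fun j =>
    Finset.single_le_sum (fun _ _ => Nat.zero_le _) (Finset.mem_univ j)
  set M := ∑ k, m k
  obtain ⟨D, N, -, hN⟩ := X.diffFattening.exists_finrank_quotComponent_eq
  -- One degree that is in the stable range (N), at least every m_j (M), and large enough for the
  -- Chinese remainder theorem.
  set d := N + (M + (M * 2 + M * 2) * s) with hd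
  have hideal : X.diffFattening.ideal = ⨅ j, diffPower K (pointIdeal (q j) ^ m j) 2 := by
    rw [← diffPower_iInf, ← h.ideal_eq]
    rfl
  have h1 := hN d (by omega)
  rw [hideal, finrank_quotComponent_iInf (a := M * 2 + M * 2)] at h1
  · rw [X.diffFattening.degree_eq_of_eventually hN, ← h1, Finset.sum_filter, Nat.cast_sum,
      ← Finset.sum_add_distrib]
    refine Finset.sum_congr rfl fun j _ => ?_
    obtain ⟨i₀, hi₀⟩ := exists_finrank_quotComponent_pointIdeal_eq (q j)
    rw [(hi₀ (m j) d).2, ← finrank_quotComponent_diffPower_coordPointIdeal_pow (K := K) p i₀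
      (h.pos j) (show m j ≤ d by have := hle j; omega)]
    push_cast
    rfl
  · exact fun j f hf d => homogeneousComponent_mem_diffPower_two
      (fun g hg d => homogeneousComponent_mem_pointIdeal_pow _ _ hg d) hf d
  · intro j k hjk
    -- The exponents are doubled because the square of I_p^m lies in its second differential power.
    refine (Ideal.pow_le_pow_right (Nat.add_le_add (Nat.mul_le_mul_right 2 (hle j))
      (Nat.mul_le_mul_right 2 (hle k)))).trans ?_
    refine (idealOfVars_pow_le_pointIdeal_pow_sup (fun h' => hjk (h.distinct h')) _ _).trans ?_
    rw [pow_mul, pow_mul]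
    exact sup_le_sup (sq_le_diffPower_two _) (sq_le_diffPower_two _)
  · rw [Fintype.card_fin]
    omega

theorem hilbertPoly_HFOmega_of_isFatPointScheme (p : ℕ) [CharP K p]
    (h : IsFatPointScheme X q m) :
    hilbertPoly X.HFOmega = Polynomial.C
      (∑ j, (((n : ℚ) + 2) * ((m j + n - 1).choose n : ℚ) - ((m j + n).choose n : ℚ)) +
        ∑ j with p ∣ m j, ({α : Fin n → ℕ | ∑ i, α i = m j / p}.ncard : ℚ)) := by
  classical
  rw [X.isHilbertPoly_HFOmega.hilbertPoly_eq, Finset.sum_sub_distrib, ← Finset.mul_sum,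
    ← degree_eq_of_isFatPointScheme h]
  congr 1
  have := degree_diffFattening_of_isFatPointScheme p h
  rw [← this]
  ring

theorem forall_eq_one_iff_of_isFatPointScheme (p : ℕ) [CharP K p]
    (h : IsFatPointScheme X q m) (hn : 1 ≤ n) :
    (∀ j, m j = 1) ↔ hilbertPoly X.HFOmega = Polynomial.C (s : ℚ) := by
  rw [hilbertPoly_HFOmega_of_isFatPointScheme p h, Polynomial.C_inj]
  have hs : (s : ℚ) = ∑ _j : Fin s, 1 := by simp
  have hone : ((n : ℚ) + 2) * ((1 + n - 1).choose n : ℚ) - ((1 + n).choose n : ℚ) = 1 := by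
    rw [show 1 + n - 1 = n by omega, Nat.choose_self, Nat.add_comm 1 n,
      Nat.choose_succ_self_right]
    push_cast
    ring
  constructor
  · intro hm
    have hp : p ≠ 1 := CharP.char_ne_one K p
    rw [hs, Finset.filter_false_of_mem, Finset.sum_empty, add_zero]
    · exact Finset.sum_congr rfl fun j _ => by rw [hm j, hone]
    · intro j _
      rw [hm j, Nat.dvd_one]
      exact hp
  · intro heq
    have hterm : ∀ j, (1 : ℚ) ≤
        ((n : ℚ) + 2) * ((m j + n - 1).choose n : ℚ) - ((m j + n).choose n : ℚ) := by
      intro j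
      rcases (h.pos j).eq_or_lt with hj | hj
      · rw [← hj, hone]
      · have := choose_fat_point_ge_two hn hj
        linarith
    by_contra! hex
    obtain ⟨j, hj⟩ := hex
    have hj2 := choose_fat_point_ge_two hn (show 2 ≤ m j by have := h.pos j; omega)
    -- A single multiplicity above 1 pushes the first sum strictly past s, and the correction cannot
    -- lower it.
    have hlt := Finset.sum_lt_sum (s := Finset.univ) (fun j _ => hterm j)
      ⟨j, Finset.mem_univ _, by linarith⟩
    have hnn : (0 : ℚ) ≤
        ∑ j with p ∣ m j, ({α : Fin n → ℕ | ∑ i, α i = m j / p}.ncard : ℚ) :=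
      Finset.sum_nonneg fun _ _ => Nat.cast_nonneg _
    rw [← hs] at hlt
    linarith

end ZeroDimScheme

end FatPoints

end

theorem corollary3p9 {K : Type*} [Field K] [PerfectField K] {n : ℕ} (X : ZeroDimScheme K n) :
    -- the Hilbert function of the module of differentials
    (∀ i : ℕ, X.HFOmega i = (n + 1) * X.HF (i - 1) + X.HF i - X.diffFattening.HF i) ∧
    -- the Hilbert polynomials exist, and those of the two schemes are constants, their degrees
    (IsHilbertPoly X.HF (Polynomial.C X.degree) ∧
      IsHilbertPoly X.diffFattening.HF (Polynomial.C X.diffFattening.degree) ∧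
      IsHilbertPoly X.HFOmega (hilbertPoly X.HFOmega)) ∧
    hilbertPoly X.HFOmega = Polynomial.C ((n + 2) * X.degree - X.diffFattening.degree) ∧
    -- the regularity indices are attained
    (IsLeast (regularitySet X.HF) (regularityIndex X.HF) ∧
      IsLeast (regularitySet X.diffFattening.HF) (regularityIndex X.diffFattening.HF) ∧
      IsLeast (regularitySet X.HFOmega) (regularityIndex X.HFOmega)) ∧
    regularityIndex X.HFOmega ≤
      max (regularityIndex X.HF + 1) (regularityIndex X.diffFattening.HF) ∧
    -- fat point schemes
    (∀ (p : ℕ) [CharP K p] (s : ℕ) (q : Fin s → Projectivization K (Fin (n + 1) → K))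
      (m : Fin s → ℕ), IsFatPointScheme X q m →
        hilbertPoly X.HFOmega = Polynomial.C
          (∑ j, (((n : ℚ) + 2) * ((m j + n - 1).choose n : ℚ) - ((m j + n).choose n : ℚ)) +
            ∑ j with p ∣ m j, ({α : Fin n → ℕ | ∑ i, α i = m j / p}.ncard : ℚ)) ∧
        (1 ≤ n → ((∀ j, m j = 1) ↔ hilbertPoly X.HFOmega = Polynomial.C (s : ℚ)))) := by
  have hΩ := X.isHilbertPoly_HFOmega
  refine ⟨X.HFOmega_natCast, ⟨X.isHilbertPoly_HF, X.diffFattening.isHilbertPoly_HF, ?_⟩,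
    hΩ.hilbertPoly_eq, ⟨X.isLeast_regularityIndex_HF, X.diffFattening.isLeast_regularityIndex_HF,
      X.isLeast_regularityIndex_HFOmega⟩, X.regularityIndex_HFOmega_le, ?_⟩
  · rwa [hΩ.hilbertPoly_eq]
  · intro p _ s q m h
    exact ⟨ZeroDimScheme.hilbertPoly_HFOmega_of_isFatPointScheme p h,
      ZeroDimScheme.forall_eq_one_iff_of_isFatPointScheme p h⟩
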